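/- **Setting.** Let $\Omega\subset\mathbb R^2$ be a bounded polygonal domain, $k\ge1$, $f\in L^2(\Omega)$, $C_0\ge 0$, $\gamma>-1$. Let $\mathcal T_0$ be a conforming triangulation of $\Omega$, $\mathcal T$ a conforming triangulation refining $\mathcal T_0$, and $\mathcal T^*$ a conforming triangulation refining $\mathcal T$. With $h_K=|K|^{1/2}$, suppose that $\mathcal T$ and $\mathcal T^*$ are shape-regular with constant $\kappa$: $\operatorname{diam}K\le\kappa h_K$ for all their elements $K$. Let $\nu$ be constant on each element of $\mathcal T_0$ with values in $(0,\tfrac12)$, and $$\mathcal C\tau=\tfrac1{1-\nu}\tau-\tfrac{\nu}{1-\nu^2}(\operatorname{tr}\tau)I,\qquad a(\sigma,\tau)=\int_\Omega\mathcal C\sigma:\tau\,dx,\qquad \|\tau\|_{\mathcal C}^2=a(\tau,\tau).$$ Put $\xi_K=C_0h_K^\gamma$ and $C_\xi=\max_{K\in\mathcal T_0}h_K\xi_K$. Let $\mathbb S$ be the symmetric $2\times2$ matrices, $P_r$ the polynomials of degree at most $r$ ($P_r=\{0\}$ for $r<0$), and $P_r(K,\mathbb S)$ the symmetric tensors with entries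 in $P_r(K)$. For $\mathcal M\in\{\mathcal T,\mathcal T^*\}$ let $\mathcal E(\mathcal M)$ be the set of its edges, $\mathcal E^i(\mathcal M)$ that of its interior edges, $$\Sigma_{\mathcal M}=\{\tau\in L^2(\Omega,\mathbb S):\tau|_K\in P_{k-1}(K,\mathbb S)\ \forall K\in\mathcal M\},\qquad V_{\mathcal M}=\{v\in H^1_0(\Omega): v|_K\in P_k(K)\ \forall K\in\mathcal M\},$$ $$M_{\mathcal M}=\{\mu:\mu|_e\in P_{k-1}(e)\ \forall e\in\mathcal E(\mathcal M),\ \mu|_{\partial\Omega}=0\}.$$ Fix a unit normal $n_e=(n_1,n_2)^T$ and the tangent $t_e=(-n_2,n_1)^T$ on every edge $e$; $n$ is the outward unit normal of $K$ on $\partial K$, and $t$ is the tangent obtained from $n$ in the same way. Set $M_n(\tau)=n_e^T\tau n_e$, $M_{nn_e}(\tau)=n_e^T\tau n$, $M_{nt}(\tau)=t_e^T\tau n_e$, $[v]=v^+n_e\cdot n^++v^-n_e\cdot n^-$ on interior edges, and $$b_{\mathcal M}(\tau,v)=-\sum_{K\in\mathcal M}\int_K(\nabla\cdot\tau)\cdot\nabla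 v\,dx+\sum_{K\in\mathcal M}\int_{\partial K}M_{nt}(\tau)\,\partial_tv\,ds .$$ Let $(\sigma_{\mathcal M},u_{\mathcal M},\lambda_{\mathcal M})\in\Sigma_{\mathcal M}\times V_{\mathcal M}\times M_{\mathcal M}$ solve the hybridizable $C^0$ discontinuous Galerkin method: for all $(\tau,v,\mu)\in\Sigma_{\mathcal M}\times V_{\mathcal M}\times M_{\mathcal M}$, $$a(\sigma_{\mathcal M},\tau)+b_{\mathcal M}(\tau,u_{\mathcal M})=-\sum_{K\in\mathcal M}\int_{\partial K}M_{nn_e}(\tau)\lambda_{\mathcal M}\,ds,$$ $$-b_{\mathcal M}(\sigma_{\mathcal M},v)+\sum_{K\in\mathcal M}\int_{\partial K}\bigl(\widehat{M_n(\sigma_{\mathcal M})}-M_n(\sigma_{\mathcal M})\bigr)\partial_nv\,ds=\int_\Omega fv\,dx,\qquad \sum_{e\in\mathcal E^i(\mathcal M)}\int_e\bigl[\widehat{M_n(\sigma_{\mathcal M})}\bigr]\mu\,ds=0,$$ where $\widehat{M_n(\sigma_{\mathcal M})}|_{\partial K}=M_n(\sigma_{\mathcal M})+\xi_K(\partial_{n_e}u_{\mathcal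 M}-\lambda_{\mathcal M})\,n_e\cdot n$. The postprocessed moment $\widehat\sigma_{\mathcal M}\in\Sigma_{\mathcal M}$ is defined by the following conditions for all $K\in\mathcal M$: $$\int_K\widehat\sigma_{\mathcal M}:\tau\,dx=\int_K\sigma_{\mathcal M}:\tau\,dx\quad\forall\tau\in P_{k-2}(K,\mathbb S),\qquad \int_eM_n(\widehat\sigma_{\mathcal M})\mu\,ds=\int_e\widehat{M_n(\sigma_{\mathcal M})}|_{\partial K}\,\mu\,ds\quad\forall\mu\in P_{k-1}(e),\ e\subset\partial K\text{ an edge}.$$ With $\boldsymbol Q_K^{k-2}$ the componentwise $L^2(K)$-orthogonal projection onto $P_{k-2}(K)$, put, for $\mathcal S\subset\mathcal T$, $$\widetilde\eta_1^2(\tau,\mathcal S)=\sum_{K\in\mathcal S}h_K\xi_K\|\mathcal C\tau-\boldsymbol Q_K^{k-2}(\mathcal C\tau)\|_{0,K}^2 .$$ **Lemma (stability of the postprocessing error).** There is a constant $C>0$ depending only on $k$ and $\kappa$ such that $$\|(\widehat\sigma_{\mathcal T^*}-\sigma_{\mathcal T^*})-(\widehat\sigma_{\mathcal T}-\sigma_{\mathcal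 T})\|_{\mathcal C}^2\le C\Bigl(C_\xi^2\|\sigma_{\mathcal T^*}-\sigma_{\mathcal T}\|_{\mathcal C}^2+C_\xi\,\widetilde\eta_1^2(\sigma_{\mathcal T},\mathcal T\setminus\mathcal T^*)\Bigr).$$ -/

import Mathlib

open MeasureTheory Filter Topology

noncomputable section

namespace HCDG

/-! ## The plane, polynomials and tensors -/

/-- The Euclidean plane `ℝ²`. -/
abbrev Plane : Type := EuclideanSpace ℝ (Fin 2)

/-- Polynomials in the two coordinates of the plane. -/
abbrev Poly : Type := MvPolynomial (Fin 2) ℝ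

/-- Second order tensors. -/
abbrev Tensor : Type := Matrix (Fin 2) (Fin 2) ℝ

/-- Tensors with polynomial entries. -/
abbrev PolyTensor : Type := Matrix (Fin 2) (Fin 2) Poly

/-- A simplex (triangle or edge), given by the finite set of its vertices. -/
abbrev Simp : Type := Finset Plane

/-- The closed point set of a simplex. -/
def hull (K : Simp) : Set Plane := convexHull ℝ (K : Set Plane)

/-- The value of a polynomial at a point. -/
def ev (p : Poly) (x : Plane) : ℝ := MvPolynomial.eval (fun i => x i) p

/-- The gradient of a polynomial at a point. -/
def grad (p : Poly) (x : Plane) : Plane :=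
  WithLp.toLp 2 (fun i => ev (MvPolynomial.pderiv i p) x)

/-- Polynomials of total degree at most `r`; only `0` if `r < 0`. -/
def polySpace (r : ℤ) : Submodule ℝ Poly :=
  MvPolynomial.restrictSupport ℝ {m | (m.degree : ℤ) ≤ r}

/-- Symmetric tensors with entries in `polySpace r`. -/
def symPolySpace (r : ℤ) : Set PolyTensor :=
  {τ | τ.IsSymm ∧ ∀ i j, τ i j ∈ polySpace r}

/-- The value of a polynomial tensor at a point. -/
def evT (τ : PolyTensor) (x : Plane) : Tensor := τ.map (fun p => ev p x)

/-- The divergence of a tensor, taken row by row. -/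
def divT (τ : PolyTensor) (x : Plane) : Plane :=
  WithLp.toLp 2 (fun i => ∑ j, ev (MvPolynomial.pderiv j (τ i j)) x)

/-- The Frobenius product `A : B`. -/
def frob (A B : Tensor) : ℝ := ∑ i, ∑ j, A i j * B i j

/-- `aᵀ A b`. -/
def bil (a : Plane) (A : Tensor) (b : Plane) : ℝ := ∑ i, ∑ j, a i * A i j * b j

/-- The rotation `(n₁, n₂) ↦ (-n₂, n₁)` which turns a unit normal into the unit tangent. -/
def rot (n : Plane) : Plane := !₂[-n 1, n 0]

/-- The operator `𝒞` for a value `ν` of the Poisson ratio. -/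
def cOp (ν : ℝ) (τ : Tensor) : Tensor :=
  (1 / (1 - ν)) • τ - (ν / (1 - ν ^ 2) * τ.trace) • (1 : Tensor)

/-! ## Triangulations -/

/-- `K` is the vertex set of a nondegenerate triangle. -/
def IsTriangle (K : Simp) : Prop :=
  K.card = 3 ∧ AffineIndependent ℝ (fun x : K => (x : Plane))

/-- The edges of a simplex. -/
def edges (K : Simp) : Finset Simp := K.powersetCard 2

open scoped Classical in
/-- All edges of a set of triangles. -/
def meshEdges (T : Finset Simp) : Finset Simp := T.biUnion edges

/-- `T` is a conforming triangulation of the open set `Ω`: finitely many nondegenerate triangles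
covering the closure of `Ω`, two of which meet at most in a common vertex or a common edge, such
that the boundary of `Ω` consists of edges. -/
structure IsTriangulation (Ω : Set Plane) (T : Finset Simp) : Prop where
  triangle : ∀ K ∈ T, IsTriangle K
  cover : (⋃ K ∈ T, hull K) = closure Ω
  conforming : ∀ K ∈ T, ∀ L ∈ T,
    hull K ∩ hull L = convexHull ℝ ((K : Set Plane) ∩ (L : Set Plane))
  boundary : frontier Ω = ⋃ e ∈ meshEdges T, ⋃ _ : hull e ⊆ frontier Ω, hull e

open scoped Classical in
/-- The edges that do not lie on the boundary of `Ω`. -/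
def interiorEdges (Ω : Set Plane) (T : Finset Simp) : Finset Simp :=
  {e ∈ meshEdges T | ¬ hull e ⊆ frontier Ω}

/-- Every element of `T'` lies in an element of `T`. -/
def IsRefinement (T T' : Finset Simp) : Prop :=
  ∀ K' ∈ T', ∃ K ∈ T, hull K' ⊆ hull K

open scoped Classical in
/-- The elements of `T` that are not elements of `T'`, i.e. `T \ T'`. -/
def refinedElements (T T' : Finset Simp) : Finset Simp := T \ T'

/-- The mesh size `h_K`, the square root of the area of `K`. -/
def meshSize (K : Simp) : ℝ := Real.sqrt (volume.real (hull K))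

/-- Shape regularity with constant `κ`. -/
def IsShapeRegular (κ : ℝ) (T : Finset Simp) : Prop :=
  ∀ K ∈ T, Metric.diam (hull K) ≤ κ * meshSize K

/-- `n` is a unit normal of the edge `e`. -/
def IsUnitNormal (e : Simp) (n : Plane) : Prop :=
  ‖n‖ = 1 ∧ ∀ x ∈ e, ∀ y ∈ e, inner ℝ n (x - y) = 0

/-- `n` is the unit normal of the edge `e` of `K` that points out of `K`. -/
def IsOutwardNormal (K e : Simp) (n : Plane) : Prop :=
  IsUnitNormal e n ∧ ∀ x ∈ K, x ∉ e → ∀ y ∈ e, inner ℝ n (x - y) < 0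

theorem triangle_vertices {K e : Simp} (hK : IsTriangle K) (he : e ∈ edges K) :
    ∃ a b c : Plane, a ≠ b ∧ K = insert a (insert b {c}) ∧ e = insert a {b} ∧
      inner ℝ (rot (b - a)) (c - a) ≠ 0 := by
  obtain ⟨h3, hind⟩ := hK
  obtain ⟨heK, h2⟩ := Finset.mem_powersetCard.mp he
  obtain ⟨a, b, hab, rfl⟩ := Finset.card_eq_two.mp h2
  obtain ⟨c, hc⟩ : ∃ c, K \ {a, b} = {c} := by
    rw [← Finset.card_eq_one, Finset.card_sdiff_of_subset heK, h2, h3]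
  have hK' : K = {a, b, c} := by
    rw [← Finset.sdiff_union_of_subset heK, hc]
    ext x; simp only [Finset.mem_union, Finset.mem_insert, Finset.mem_singleton]; tauto
  refine ⟨a, b, c, hab, hK', rfl, fun h0 => ?_⟩
  have hcol : Collinear ℝ (Set.range (fun x : K => (x : Plane))) := by
    have ha : a ∈ Set.range (fun x : K => (x : Plane)) := ⟨⟨a, heK (by simp)⟩, rfl⟩
    rw [collinear_iff_of_mem ha]
    have hne : (b - a) 0 ^ 2 + (b - a) 1 ^ 2 ≠ 0 := by
      intro h
      apply hab
      have e0 : (b - a) 0 = 0 := by nlinarith [sq_nonneg ((b - a) 0), sq_nonneg ((b - a) 1)]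
      have e1 : (b - a) 1 = 0 := by nlinarith [sq_nonneg ((b - a) 0), sq_nonneg ((b - a) 1)]
      have : b - a = 0 := by ext i; fin_cases i <;> simpa using by assumption
      exact (sub_eq_zero.mp this).symm
    refine ⟨b - a, ?_⟩
    rintro _ ⟨⟨p, hp⟩, rfl⟩
    rw [hK'] at hp
    simp only [Finset.mem_insert, Finset.mem_singleton] at hp
    rcases hp with rfl | rfl | rfl
    · exact ⟨0, by simp⟩
    · exact ⟨1, by simp⟩
    · have h1 : (b - a) 0 * (p - a) 1 - (b - a) 1 * (p - a) 0 = 0 := by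
        rw [← h0]; simp [rot, PiLp.inner_apply, Fin.sum_univ_two]; ring
      refine ⟨((b - a) 0 * (p - a) 0 + (b - a) 1 * (p - a) 1)
        / ((b - a) 0 ^ 2 + (b - a) 1 ^ 2), ?_⟩
      have e0 : p 0 = (p - a) 0 + a 0 := by simp
      have e1 : p 1 = (p - a) 1 + a 1 := by simp
      simp only [vadd_eq_add]
      ext i
      fin_cases i
      · simp only [Fin.zero_eta, PiLp.add_apply, PiLp.smul_apply, smul_eq_mul]
        rw [e0, add_left_inj, div_mul_eq_mul_div, eq_div_iff hne]
        linear_combination (-(b - a) 1) * h1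
      · simp only [Fin.mk_one, PiLp.add_apply, PiLp.smul_apply, smul_eq_mul]
        rw [e1, add_left_inj, div_mul_eq_mul_div, eq_div_iff hne]
        linear_combination ((b - a) 0) * h1
  have hfr := hind.finrank_vectorSpan (n := 2) (by simpa using h3)
  have := collinear_iff_finrank_le_one.mp hcol
  omega

theorem exists_isOutwardNormal {K e : Simp} (hK : IsTriangle K) (he : e ∈ edges K) :
    ∃ n, IsOutwardNormal K e n := by
  obtain ⟨a, b, c, hab, hKs, hes, hne⟩ := triangle_vertices hK he
  obtain ⟨hd, hn⟩ : 0 < ‖rot (b - a)‖ ∧ inner ℝ (rot (b - a)) (c - a) ≠ 0 := by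
    refine ⟨?_, hne⟩
    rw [norm_pos_iff]
    intro h0
    exact hne (by rw [h0, inner_zero_left])
  have hperp : inner ℝ (rot (b - a)) (b - a) = 0 := by
    simp [rot, PiLp.inner_apply, Fin.sum_univ_two]; ring
  set w := rot (b - a) with hw
  set s : ℝ := inner ℝ w (c - a) with hs
  have hsa : 0 < |s| := abs_pos.mpr hn
  refine ⟨(-(s / |s|) * ‖w‖⁻¹) • w, ⟨?_, ?_⟩, ?_⟩
  · rw [norm_smul, norm_mul, norm_neg, norm_div, norm_inv, norm_norm, Real.norm_eq_abs,
      Real.norm_eq_abs, abs_abs, div_self hsa.ne', one_mul, inv_mul_cancel₀ hd.ne']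
  · intro x hx y hy
    rw [hes] at hx hy
    simp only [Finset.mem_insert, Finset.mem_singleton] at hx hy
    have h1 : inner ℝ w (a - b) = 0 := by rw [← neg_sub b a, inner_neg_right, hperp, neg_zero]
    rcases hx with rfl | rfl <;> rcases hy with rfl | rfl <;>
      simp only [inner_smul_left, sub_self, inner_zero_right, hperp, h1, mul_zero]
  · intro x hx hxe y hy
    rw [hes] at hxe hy
    rw [hKs] at hx
    simp only [Finset.mem_insert, Finset.mem_singleton] at hx hy hxe
    have hxc : x = c := by tauto
    have h2 : inner ℝ w (c - y) = s := by
      rcases hy with rfl | rfl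
      · rfl
      · have : c - y = (c - a) - (y - a) := by abel
        rw [this, inner_sub_right, hperp, sub_zero]
    rw [hxc, inner_smul_left, h2]
    simp only [conj_trivial]
    have h3 : -(s / |s|) * ‖w‖⁻¹ * s = -(|s| * ‖w‖⁻¹) := by
      have : s * s = |s| * |s| := (abs_mul_abs_self s).symm
      field_simp
      nlinarith
    rw [h3]
    have := mul_pos hsa (inv_pos.mpr hd)
    linarith

open scoped Classical in
/-- The unit outward normal of `K` on its edge `e`. -/
def outNormal (K e : Simp) : Plane :=
  if h : ∃ n, IsOutwardNormal K e n then h.choose else 0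

theorem outNormal_spec {K e : Simp} (hK : IsTriangle K) (he : e ∈ edges K) :
    IsOutwardNormal K e (outNormal K e) := by
  have h := exists_isOutwardNormal hK he
  rw [outNormal, dif_pos h]
  exact h.choose_spec

/-! ## Integrals and the `L²` projection -/

/-- The integral over an element. -/
def intElem (K : Simp) (g : Plane → ℝ) : ℝ := ∫ x in hull K, g x

/-- The integral over an edge with respect to arc length. -/
def intEdge (e : Simp) (g : Plane → ℝ) : ℝ := ∫ x in hull e, g x ∂(Measure.hausdorffMeasure 1)

/-- The integral over the boundary of an element; the integrand may depend on the edge. -/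
def intBdry (K : Simp) (g : Simp → Plane → ℝ) : ℝ := ∑ e ∈ edges K, intEdge e (g e)

/-- `q` is the `L²(K)`-orthogonal projection of `g` onto the polynomials of degree at most `r`. -/
def IsL2Proj (K : Simp) (r : ℤ) (g : Plane → ℝ) (q : Poly) : Prop :=
  q ∈ polySpace r ∧ ∀ w ∈ polySpace r, intElem K (fun x => (g x - ev q x) * ev w x) = 0

theorem finite_polySpace (r : ℤ) : Module.Finite ℝ (polySpace r) := by
  have hfin : {m : Fin 2 →₀ ℕ | (m.degree : ℤ) ≤ r}.Finite := by
    refine (Set.finite_Iic (Finsupp.equivFunOnFinite.symm (fun _ : Fin 2 => r.toNat))).subset ?_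
    intro m hm i
    have h1 : m i ≤ m.degree := Finsupp.le_degree i m
    simp only [Set.mem_ofPred_eq] at hm
    simp only [Finsupp.equivFunOnFinite_symm_apply_apply]
    omega
  have : Finite {m : Fin 2 →₀ ℕ | (m.degree : ℤ) ≤ r} := hfin
  exact Module.Finite.of_basis (MvPolynomial.basisRestrictSupport ℝ _)

theorem continuous_ev (p : Poly) : Continuous (ev p) := by
  exact (MvPolynomial.continuous_eval p).comp (by fun_prop)

theorem memLp_ev (K : Simp) (p : Poly) : MemLp (ev p) 2 (volume.restrict (hull K)) := by
  have hc : IsCompact (hull K) := K.finite_toSet.isCompact_convexHull ℝ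
  have : IsFiniteMeasure (volume.restrict (hull K)) :=
    ⟨by rw [Measure.restrict_apply_univ]; exact hc.measure_lt_top⟩
  obtain ⟨C, hC⟩ := hc.exists_bound_of_continuousOn (continuous_ev p).continuousOn
  exact MemLp.of_bound (continuous_ev p).aestronglyMeasurable C
    ((ae_restrict_iff' hc.measurableSet).mpr (Filter.Eventually.of_forall hC))

theorem exists_isL2Proj (K : Simp) (r : ℤ) {g : Plane → ℝ}
    (hg : MemLp g 2 (volume.restrict (hull K))) : ∃ q, IsL2Proj K r g q := by
  have hev := memLp_ev K
  let L : Poly →ₗ[ℝ] Lp ℝ 2 (volume.restrict (hull K)) :=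
    { toFun := fun p => (hev p).toLp
      map_add' := fun p q => by
        rw [← MemLp.toLp_add]
        congr 1
        ext x; simp [ev]
      map_smul' := fun c p => by
        rw [RingHom.id_apply, ← MemLp.toLp_const_smul]
        congr 1
        ext x; simp [ev, MvPolynomial.smul_eval] }
  let S := (polySpace r).map L
  have := finite_polySpace r
  have : FiniteDimensional ℝ S := inferInstanceAs (Module.Finite ℝ ((polySpace r).map L))
  obtain ⟨q, hq, hqS⟩ : S.starProjection hg.toLp ∈ S := Submodule.starProjection_apply_mem _ _
  refine ⟨q, hq, fun w hw => ?_⟩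
  have h := Submodule.starProjection_inner_eq_zero (K := S) hg.toLp (L w) ⟨w, hw, rfl⟩
  rw [← hqS, L2.inner_def] at h
  rw [intElem, ← h]
  refine integral_congr_ae ?_
  have e1 : ((hev q).toLp : Lp ℝ 2 (volume.restrict (hull K))) = L q := rfl
  have e2 : ((hev w).toLp : Lp ℝ 2 (volume.restrict (hull K))) = L w := rfl
  rw [← e1, ← e2]
  filter_upwards [Lp.coeFn_sub hg.toLp ((hev q).toLp), hg.coeFn_toLp, (hev q).coeFn_toLp,
    (hev w).coeFn_toLp] with x h1 h2 h3 h4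
  rw [h1, Pi.sub_apply, h2, h3, h4]
  simp [mul_comm]

open scoped Classical in
/-- The projection `Q_K^r`. -/
def l2Proj (K : Simp) (r : ℤ) (g : Plane → ℝ) : Poly :=
  if h : ∃ q, IsL2Proj K r g q then h.choose else 0

theorem l2Proj_spec (K : Simp) (r : ℤ) {g : Plane → ℝ}
    (hg : MemLp g 2 (volume.restrict (hull K))) : IsL2Proj K r g (l2Proj K r g) := by
  have h := exists_isL2Proj K r hg
  rw [l2Proj, dif_pos h]
  exact h.choose_spec

/-- The projection `Q_K^r`, applied to each component of a tensor scalarField. -/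
def l2ProjT (K : Simp) (r : ℤ) (τ : Plane → Tensor) : PolyTensor :=
  Matrix.of (fun i j => l2Proj K r (fun x => τ x i j))

/-! ## Finite element spaces

A function that is a polynomial on each element of a triangulation is recorded by the family
of these polynomials, so that its traces from either side of an edge are available. The values
of a family at simplices that do not belong to the triangulation play no role. -/

/-- The function on the plane made of the pieces `g K`, `K ∈ T` (and `0` on the edges, a null
set, and outside the triangulation). -/
def glue {X : Type*} [AddCommMonoid X] (T : Finset Simp) (g : Simp → Plane → X) (x : Plane) : X :=
  ∑ K ∈ T, (interior (hull K)).indicator (g K) x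

/-- The scalar function given by a family of polynomials. -/
def scalarField (T : Finset Simp) (v : Simp → Poly) : Plane → ℝ := glue T (fun K => ev (v K))

/-- The tensor scalarField given by a family of polynomial tensors. -/
def tensorField (T : Finset Simp) (τ : Simp → PolyTensor) : Plane → Tensor :=
  glue T (fun K => evT (τ K))

/-- `v ∈ H¹₀(Ω)`: `v` and a vector scalarField `g` in `L²(Ω)` (then the weak gradient of `v`) are the
`L²(Ω)` limits of test functions on `Ω` and of their gradients. -/
def MemH10 (Ω : Set Plane) (v : Plane → ℝ) : Prop :=
  MemLp v 2 (volume.restrict Ω) ∧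
  ∃ g : Plane → Plane, MemLp g 2 (volume.restrict Ω) ∧
    ∃ φ : ℕ → Plane → ℝ,
      (∀ n, ContDiff ℝ (⊤ : ℕ∞) (φ n) ∧ HasCompactSupport (φ n) ∧ tsupport (φ n) ⊆ Ω) ∧
      Tendsto (fun n => eLpNorm (fun x => φ n x - v x) 2 (volume.restrict Ω)) atTop (𝓝 0) ∧
      Tendsto (fun n => eLpNorm (fun x => gradient (φ n) x - g x) 2 (volume.restrict Ω))
        atTop (𝓝 0)

/-- The space `Σ_T` of discontinuous symmetric tensors of degree at most `k - 1`. -/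
def sigmaSpace (T : Finset Simp) (k : ℕ) : Set (Simp → PolyTensor) :=
  {τ | ∀ K ∈ T, τ K ∈ symPolySpace ((k : ℤ) - 1)}

/-- The space `V_T` of functions in `H¹₀(Ω)` that are of degree at most `k` on each element. -/
def vSpace (Ω : Set Plane) (T : Finset Simp) (k : ℕ) : Set (Simp → Poly) :=
  {v | (∀ K ∈ T, v K ∈ polySpace k) ∧ MemH10 Ω (scalarField T v)}

/-- The space `M_T` of functions on the edges that are of degree at most `k - 1` on each edge and
vanish on the boundary. A polynomial on an edge is recorded by a polynomial on the plane, of which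
only the values on that edge matter. -/
def mSpace (Ω : Set Plane) (T : Finset Simp) (k : ℕ) : Set (Simp → Poly) :=
  {μ | (∀ e ∈ meshEdges T, μ e ∈ polySpace ((k : ℤ) - 1)) ∧
    ∀ e ∈ meshEdges T, hull e ⊆ frontier Ω → ∀ x ∈ hull e, ev (μ e) x = 0}

/-! ## The method -/

/-- `a(σ, τ) = ∫_Ω 𝒞σ : τ`. -/
def aForm (Ω : Set Plane) (ν : Plane → ℝ) (σ τ : Plane → Tensor) : ℝ :=
  ∫ x in Ω, frob (cOp (ν x) (σ x)) (τ x)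

/-- The energy norm `‖τ‖_𝒞 = a(τ, τ)^{1/2}`. -/
def normC (Ω : Set Plane) (ν : Plane → ℝ) (τ : Plane → Tensor) : ℝ :=
  Real.sqrt (aForm Ω ν τ τ)

/-- The bilinear form `b_T`. On the boundary of `K`, the normal and the tangent are those of `K`
(the twisting moment does not depend on the orientation of the normal). -/
def bForm (T : Finset Simp) (τ : Simp → PolyTensor) (v : Simp → Poly) : ℝ :=
  - (∑ K ∈ T, intElem K (fun x => inner ℝ (divT (τ K) x) (grad (v K) x)))
  + ∑ K ∈ T, intBdry K (fun e x =>
      bil (rot (outNormal K e)) (evT (τ K) x) (outNormal K e) *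
        inner ℝ (rot (outNormal K e)) (grad (v K) x))

/-- The stabilization parameter `ξ_K = C₀ h_K^γ`. -/
def stab (C₀ γ : ℝ) (K : Simp) : ℝ := C₀ * meshSize K ^ γ

/-- `C_ξ`, the maximum of `h_K ξ_K` over the initial triangulation. -/
def stabConst (C₀ γ : ℝ) (T₀ : Finset Simp) : ℝ :=
  ⨆ K : {K // K ∈ T₀}, meshSize K * stab C₀ γ K

/-- The trace from `K` on its edge `e` of the numerical normal bending moment,
`M_n(σ) + ξ (∂_{n_e} u - λ) n_e · n`. -/
def flux (C₀ γ : ℝ) (nE : Simp → Plane) (σ : Simp → PolyTensor) (u lam : Simp → Poly)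
    (K e : Simp) (x : Plane) : ℝ :=
  bil (nE e) (evT (σ K) x) (nE e)
    + stab C₀ γ K * (inner ℝ (nE e) (grad (u K) x) - ev (lam e) x)
      * inner ℝ (nE e) (outNormal K e)

open scoped Classical in
/-- The jump on an edge `e` of a function with trace `g K` from the element `K`. -/
def jump (T : Finset Simp) (nE : Simp → Plane) (e : Simp) (g : Simp → Plane → ℝ) (x : Plane) : ℝ :=
  ∑ K ∈ T with e ∈ edges K, g K x * inner ℝ (nE e) (outNormal K e)

/-- `(σ, u, λ)` is a solution of the hybridizable `C⁰` discontinuous Galerkin method of degree `k`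
with load `f`; `nE e` is the fixed unit normal of the edge `e`. -/
structure IsSolution (Ω : Set Plane) (T : Finset Simp) (k : ℕ) (nE : Simp → Plane)
    (ν f : Plane → ℝ) (C₀ γ : ℝ) (σ : Simp → PolyTensor) (u lam : Simp → Poly) : Prop where
  mem_sigma : σ ∈ sigmaSpace T k
  mem_v : u ∈ vSpace Ω T k
  mem_m : lam ∈ mSpace Ω T k
  eq_moment : ∀ τ ∈ sigmaSpace T k,
    aForm Ω ν (tensorField T σ) (tensorField T τ) + bForm T τ u =
      - ∑ K ∈ T, intBdry K (fun e x =>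
          bil (nE e) (evT (τ K) x) (outNormal K e) * ev (lam e) x)
  eq_load : ∀ v ∈ vSpace Ω T k,
    - bForm T σ v + ∑ K ∈ T, intBdry K (fun e x =>
        (flux C₀ γ nE σ u lam K e x - bil (nE e) (evT (σ K) x) (nE e)) *
          inner ℝ (outNormal K e) (grad (v K) x)) =
      ∫ x in Ω, f x * scalarField T v x
  eq_flux : ∀ μ ∈ mSpace Ω T k,
    ∑ e ∈ interiorEdges Ω T, intEdge e (fun x =>
      jump T nE e (fun K => flux C₀ γ nE σ u lam K e) x * ev (μ e) x) = 0

/-- `σh` is the postprocessed bending moment of the discrete solution `(σ, u, λ)`. -/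
structure IsPostprocessed (T : Finset Simp) (k : ℕ) (nE : Simp → Plane) (C₀ γ : ℝ)
    (σ : Simp → PolyTensor) (u lam : Simp → Poly) (σh : Simp → PolyTensor) : Prop where
  mem_sigma : σh ∈ sigmaSpace T k
  moments : ∀ K ∈ T, ∀ τ ∈ symPolySpace ((k : ℤ) - 2),
    intElem K (fun x => frob (evT (σh K) x) (evT τ x)) =
      intElem K (fun x => frob (evT (σ K) x) (evT τ x))
  normal : ∀ K ∈ T, ∀ e ∈ edges K, ∀ μ ∈ polySpace ((k : ℤ) - 1),
    intEdge e (fun x => bil (nE e) (evT (σh K) x) (nE e) * ev μ x) =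
      intEdge e (fun x => flux C₀ γ nE σ u lam K e x * ev μ x)

/-- The estimator `η̃₁²(τ, S) = ∑_{K ∈ S} h_K ξ_K ‖𝒞τ - Q_K^{k-2}(𝒞τ)‖²_{0,K}`. -/
def etaSq (k : ℕ) (ν : Plane → ℝ) (C₀ γ : ℝ) (τ : Simp → PolyTensor) (S : Finset Simp) : ℝ :=
  ∑ K ∈ S, meshSize K * stab C₀ γ K *
    intElem K (fun x =>
      frob (cOp (ν x) (evT (τ K) x)
          - evT (l2ProjT K ((k : ℤ) - 2) (fun y => cOp (ν y) (evT (τ K) y))) x)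
        (cOp (ν x) (evT (τ K) x)
          - evT (l2ProjT K ((k : ℤ) - 2) (fun y => cOp (ν y) (evT (τ K) y))) x))

/-- The Poisson ratio is constant in the interior of each element of `T₀`, with a value in
`(0, 1/2)`. -/
def IsPoissonRatio (T₀ : Finset Simp) (ν : Plane → ℝ) : Prop :=
  ∀ K ∈ T₀, ∃ c : ℝ, 0 < c ∧ c < 1 / 2 ∧ ∀ x ∈ interior (hull K), ν x = c

end HCDG

end

/-!
On an element `K` put `δ = σh - σ`. By definition of the postprocessing, `δ` is orthogonal to the
symmetric tensors of degree at most `k - 2`, and its normal-normal trace has the same moments of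
degree `k - 1` as `ξ_K (∂_n u - λ)`, up to orientation. The moment equation of the method, tested
with a tensor `τ` supported on `K`, becomes after integration by parts
`∫_K (𝒞σ + ∇²u) : τ = ∑_e ∫_e M_n(τ) (∂_{n_e} u - λ) n_e · n`. The Hessian of `u` has degree at most
`k - 2`. Hence, for every `τ` orthogonal to the tensors of degree at most `k - 2` and every `q` among
them (`intBdry_correction`),

  `∑_e ∫_e M_n(δ) M_n(τ) = ξ_K ∫_K (𝒞σ - q) : τ`.

The second ingredient is the inverse trace inequality `‖δ‖²_K ≤ C h_K ‖M_n(δ)‖²_{∂K}` for tensors `δ`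
orthogonal to those of degree at most `k - 2` (`exists_frob_le_intBdry`). A symmetric tensor is
controlled by its three normal-normal components (`frob_self_le_sum_bil`). Each component `nᵀδn` is a
polynomial of degree at most `k - 1`, orthogonal to the lower ones, and such a polynomial is
controlled by its trace on the edge: if the trace vanishes, the polynomial is `y q` with `y` the
height over the edge, and orthogonality to `q` forces `q = 0` (`exists_intElem_le_intEdge`).

Choosing `τ = δ` gives `‖δ‖_K ≤ C h_K ξ_K ‖𝒞σ - q‖_K` (`exists_stability`). On elements common to both
triangulations this is applied to the difference of the two corrections, which corresponds to the
difference of the moments. On a fine element inside a refined element `K` of the coarse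
triangulation, `q` is taken to be the projection `Q_K (𝒞σ)` of the coarse moment, so that
`𝒞σs - q = 𝒞(σs - σ) + (𝒞σ - Q_K 𝒞σ)`. As `γ > -1`, the weight `h ξ` of an element is at most that of
any element containing it, and summation over the elements gives the estimate.
-/

noncomputable section

namespace HCDG

/-! ### Polynomials on the plane -/

theorem mem_polySpace {r : ℤ} {p : Poly} :
    p ∈ polySpace r ↔ ∀ m ∈ p.support, (m.degree : ℤ) ≤ r := by
  rw [polySpace, MvPolynomial.mem_restrictSupport_iff]
  rfl

theorem polySpace_mono {r s : ℤ} (h : r ≤ s) : polySpace r ≤ polySpace s := fun _ hp =>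
  mem_polySpace.mpr fun m hm => (mem_polySpace.mp hp m hm).trans h

@[simp] theorem ev_add (p q : Poly) (x : Plane) : ev (p + q) x = ev p x + ev q x := by simp [ev]
@[simp] theorem ev_sub (p q : Poly) (x : Plane) : ev (p - q) x = ev p x - ev q x := by simp [ev]
@[simp] theorem ev_neg (p : Poly) (x : Plane) : ev (-p) x = -ev p x := by simp [ev]
@[simp] theorem ev_mul (p q : Poly) (x : Plane) : ev (p * q) x = ev p x * ev q x := by simp [ev]
@[simp] theorem ev_zero (x : Plane) : ev 0 x = 0 := by simp [ev]
@[simp] theorem ev_C (c : ℝ) (x : Plane) : ev (MvPolynomial.C c) x = c := by simp [ev]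
@[simp] theorem ev_X (i : Fin 2) (x : Plane) : ev (MvPolynomial.X i) x = x i := by simp [ev]
@[simp] theorem ev_smul (c : ℝ) (p : Poly) (x : Plane) : ev (c • p) x = c * ev p x := by
  simp [ev, MvPolynomial.smul_eval]
@[simp] theorem ev_sum {ι : Type*} (s : Finset ι) (p : ι → Poly) (x : Plane) :
    ev (∑ i ∈ s, p i) x = ∑ i ∈ s, ev (p i) x := by simp [ev]

theorem mul_mem_polySpace {r s : ℤ} {p q : Poly} (hp : p ∈ polySpace r) (hq : q ∈ polySpace s) :
    p * q ∈ polySpace (r + s) := by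
  classical
  rw [mem_polySpace] at *
  intro m hm
  obtain ⟨a, ha, b, hb, rfl⟩ := Finset.mem_add.mp (MvPolynomial.support_mul p q hm)
  have := hp a ha
  have := hq b hb
  rw [map_add]
  push_cast
  linarith

theorem C_mem_polySpace (c : ℝ) : MvPolynomial.C c ∈ polySpace 0 := by
  rw [mem_polySpace]
  intro m hm
  rw [MvPolynomial.mem_support_iff, MvPolynomial.coeff_C] at hm
  have : m = 0 := by by_contra h; exact hm (if_neg fun h' => h h'.symm)
  simp [this]

theorem X_mem_polySpace (i : Fin 2) : MvPolynomial.X i ∈ polySpace 1 := by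
  rw [mem_polySpace]
  intro m hm
  rw [MvPolynomial.support_X, Finset.mem_singleton] at hm
  simp [hm]

theorem pow_mem_polySpace {p : Poly} (hp : p ∈ polySpace 1) (n : ℕ) : p ^ n ∈ polySpace n := by
  induction n with
  | zero => simpa using C_mem_polySpace 1
  | succ n ih =>
    rw [pow_succ, Nat.cast_succ]
    exact mul_mem_polySpace ih hp

theorem pderiv_mem_polySpace {r : ℤ} {p : Poly} (hp : p ∈ polySpace r) (i : Fin 2) :
    MvPolynomial.pderiv i p ∈ polySpace (r - 1) := by
  rw [mem_polySpace] at hp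
  rw [p.as_sum, map_sum]
  refine Submodule.sum_mem _ fun m hm => ?_
  rw [MvPolynomial.pderiv_monomial]
  by_cases h0 : m i = 0
  · simp [h0]
  rw [mem_polySpace]
  intro m' hm'
  have := MvPolynomial.support_monomial_subset hm'
  rw [Finset.mem_singleton] at this
  have hdeg := hp m hm
  have h1 : m = m' + Finsupp.single i 1 := by
    rw [this]
    ext j
    by_cases hj : j = i
    · subst hj; simp; omega
    · simp [hj]
  have h2 : m.degree = m'.degree + 1 := by rw [h1]; simp
  push_cast [h2] at hdeg
  linarith

/-- Composition with a pair of polynomials of degree at most one does not raise the degree. -/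
theorem bind₁_mem_polySpace {r : ℤ} {p : Poly} (hp : p ∈ polySpace r) {L : Fin 2 → Poly}
    (hL : ∀ i, L i ∈ polySpace 1) : MvPolynomial.bind₁ L p ∈ polySpace r := by
  rw [mem_polySpace] at hp
  rw [p.as_sum, map_sum]
  refine Submodule.sum_mem _ fun m hm => ?_
  rw [MvPolynomial.bind₁_monomial]
  refine polySpace_mono (hp m hm) ?_
  have h2 : (∏ i ∈ m.support, L i ^ m i) = L 0 ^ m 0 * L 1 ^ m 1 := by
    rw [← Fin.prod_univ_two (fun i => L i ^ m i)]
    refine Finset.prod_subset (Finset.subset_univ _) fun i _ hi => ?_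
    rw [Finsupp.notMem_support_iff.mp hi, pow_zero]
  have h3 : m.degree = m 0 + m 1 := by
    rw [Finsupp.degree_eq_sum, Fin.sum_univ_two]
  rw [h2, h3]
  have := mul_mem_polySpace (C_mem_polySpace (p.coeff m))
    (mul_mem_polySpace (pow_mem_polySpace (hL 0) (m 0)) (pow_mem_polySpace (hL 1) (m 1)))
  simpa using this

theorem ev_bind₁ (L : Fin 2 → Poly) (p : Poly) (x : Plane) :
    ev (MvPolynomial.bind₁ L p) x = ev p (WithLp.toLp 2 fun i => ev (L i) x) := by
  simp only [ev]
  rw [← MvPolynomial.coe_aeval_eq_eval, ← MvPolynomial.coe_aeval_eq_eval, RingHom.coe_coe,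
    RingHom.coe_coe, MvPolynomial.aeval_bind₁]

theorem grad_inner (p : Poly) (x v : Plane) :
    inner ℝ v (grad p x) =
      v 0 * ev (MvPolynomial.pderiv 0 p) x + v 1 * ev (MvPolynomial.pderiv 1 p) x := by
  simp [grad, PiLp.inner_apply, Fin.sum_univ_two, mul_comm]

/-- The derivative of a polynomial along a line. -/
theorem hasDerivAt_ev_line (p : Poly) (x v : Plane) (t : ℝ) :
    HasDerivAt (fun t : ℝ => ev p (x + t • v)) (inner ℝ v (grad p (x + t • v))) t := by
  rw [grad_inner]
  induction p using MvPolynomial.induction_on with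
  | C c => simpa using hasDerivAt_const t c
  | add p q hp hq =>
    simp only [ev_add, map_add]
    exact (hp.add hq).congr_deriv (by ring)
  | mul_X p i hp =>
    have hX : HasDerivAt (fun t : ℝ => x i + t * v i) (v i) t := by
      simpa using ((hasDerivAt_id t).mul_const (v i)).const_add (x i)
    simp only [ev_mul, ev_X, PiLp.add_apply, PiLp.smul_apply, smul_eq_mul]
    refine (hp.mul hX).congr_deriv ?_
    fin_cases i <;>
    · simp [Derivation.leibniz, MvPolynomial.pderiv_X]
      ring

theorem continuous_grad (p : Poly) : Continuous (grad p) := by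
  have := continuous_ev (MvPolynomial.pderiv 0 p)
  have := continuous_ev (MvPolynomial.pderiv 1 p)
  refine (PiLp.continuous_toLp 2 _).comp (continuous_pi fun i => ?_)
  exact continuous_ev _

/-- A polynomial that vanishes on an open set is zero. -/
theorem eq_zero_of_ev_eq_zero {p : Poly} {s : Fin 2 → Set ℝ} (hs : ∀ i, (s i).Infinite)
    (h : ∀ x : Plane, (∀ i, x i ∈ s i) → ev p x = 0) : p = 0 := by
  refine MvPolynomial.funext_set s hs fun x hx => ?_
  rw [map_zero]
  exact h (WithLp.toLp 2 x) fun i => hx i trivial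

/-- A polynomial of degree at most `r` that vanishes on the segment from `(0,0)` to `(1,0)` is the
product of the second coordinate and a polynomial of degree at most `r - 1`. -/
theorem exists_X_mul_of_vanish {r : ℤ} {p : Poly} (hp : p ∈ polySpace r)
    (h : ∀ s ∈ Set.Icc (0 : ℝ) 1, ev p !₂[s, 0] = 0) :
    ∃ q ∈ polySpace (r - 1), p = MvPolynomial.X 1 * q := by
  set q := p.divMonomial (Finsupp.single 1 1) with hq
  set m := p.modMonomial (Finsupp.single 1 1) with hm
  have hdm : MvPolynomial.X 1 * q + m = p := MvPolynomial.divMonomial_add_modMonomial_single p 1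
  have hm0 : m = 0 := by
    -- the remainder `m` does not contain the second variable
    have hinv : ∀ x : Plane, ev m x = ev m !₂[x 0, 0] := by
      intro x
      simp only [ev, MvPolynomial.eval_eq]
      refine Finset.sum_congr rfl fun d hd => ?_
      have hd1 : d 1 = 0 := by
        by_contra h1
        rw [MvPolynomial.mem_support_iff] at hd
        refine hd (MvPolynomial.coeff_modMonomial_of_le _ ?_)
        rw [Finsupp.single_le_iff]; omega
      congr 1
      refine Finset.prod_congr rfl fun i hi => ?_
      fin_cases i
      · rfl
      · simp [hd1]
    refine eq_zero_of_ev_eq_zero (s := ![Set.Icc 0 1, Set.univ]) ?_ fun x hx => ?_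
    · intro i
      fin_cases i
      · exact Set.Icc_infinite (zero_lt_one (α := ℝ))
      · exact Set.infinite_univ
    · have h0 := h (x 0) (hx 0)
      rw [← hdm] at h0
      rw [hinv]
      simpa using h0
  refine ⟨q, ?_, by rw [← hdm, hm0, add_zero]⟩
  rw [mem_polySpace] at *
  intro d hd
  have : d + Finsupp.single 1 1 ∈ p.support := by
    rw [MvPolynomial.mem_support_iff] at hd ⊢
    rwa [hq, MvPolynomial.coeff_divMonomial, add_comm] at hd
  have := hp _ this
  simp at this
  linarith

/-! ### Parametrization of triangles and edges -/

/-- The oriented area of the parallelogram spanned by `u` and `v`. -/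
def cross (u v : Plane) : ℝ := u 0 * v 1 - u 1 * v 0

theorem inner_eq (u v : Plane) : inner ℝ u v = u 0 * v 0 + u 1 * v 1 := by
  simp [PiLp.inner_apply, Fin.sum_univ_two, mul_comm]

theorem inner_rot (u v : Plane) : inner ℝ (rot u) v = cross u v := by
  rw [inner_eq]; simp [rot, cross]; ring

theorem plane_norm_sq (u : Plane) : ‖u‖ ^ 2 = u 0 ^ 2 + u 1 ^ 2 := by
  rw [EuclideanSpace.norm_sq_eq]; simp [Fin.sum_univ_two]

/-- The triangle with the vertices `(0,0)`, `(1,0)`, `(0,1)`. -/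
def refTri : Set Plane := {x | 0 ≤ x 0 ∧ 0 ≤ x 1 ∧ x 0 + x 1 ≤ 1}

/-- The linear map with columns `u` and `v`. -/
def colMap (u v : Plane) : Plane →L[ℝ] Plane :=
  LinearMap.toContinuousLinearMap
    { toFun := fun x => x 0 • u + x 1 • v
      map_add' := fun x y => by simp only [PiLp.add_apply]; module
      map_smul' := fun r x => by
        simp only [PiLp.smul_apply, smul_eq_mul, RingHom.id_apply]; module }

@[simp] theorem colMap_apply (u v x : Plane) : colMap u v x = x 0 • u + x 1 • v := rfl

theorem colMap_det (u v : Plane) : (colMap u v).det = cross u v := by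
  have h : (colMap u v).det = LinearMap.det (colMap u v : Plane →ₗ[ℝ] Plane) := rfl
  rw [h, ← LinearMap.det_toMatrix (EuclideanSpace.basisFun (Fin 2) ℝ).toBasis, Matrix.det_fin_two]
  simp [LinearMap.toMatrix_apply, cross]
  ring

/-- The affine map that takes the vertices of the reference triangle to `a`, `b`, `c`. -/
def triMap (a b c : Plane) (x : Plane) : Plane := a + colMap (b - a) (c - a) x

theorem continuous_triMap (a b c : Plane) : Continuous (triMap a b c) :=
  continuous_const.add (colMap (b - a) (c - a)).continuous

theorem triMap_apply (a b c x : Plane) (i : Fin 2) :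
    triMap a b c x i = a i + (x 0 * (b i - a i) + x 1 * (c i - a i)) := by
  simp [triMap]

theorem triMap_injective {a b c : Plane} (h : cross (b - a) (c - a) ≠ 0) :
    Function.Injective (triMap a b c) := by
  intro x y hxy
  have h0 := congrArg (fun p : Plane => p 0) hxy
  have h1 := congrArg (fun p : Plane => p 1) hxy
  simp only [triMap_apply] at h0 h1
  simp only [cross, PiLp.sub_apply] at h
  ext i
  fin_cases i
  · refine mul_left_cancel₀ h ?_
    change _ * x 0 = _ * y 0
    linear_combination (c 1 - a 1) * h0 - (c 0 - a 0) * h1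
  · refine mul_left_cancel₀ h ?_
    change _ * x 1 = _ * y 1
    linear_combination (b 0 - a 0) * h1 - (b 1 - a 1) * h0

theorem convex_refTri : Convex ℝ refTri := by
  rintro x ⟨hx0, hx1, hx⟩ y ⟨hy0, hy1, hy⟩ s t hs ht hst
  refine ⟨?_, ?_, ?_⟩ <;> simp only [PiLp.add_apply, PiLp.smul_apply, smul_eq_mul]
  · positivity
  · positivity
  · nlinarith

theorem isClosed_refTri : IsClosed refTri := by
  have h0 : Continuous fun x : Plane => x 0 := by fun_prop
  have h1 : Continuous fun x : Plane => x 1 := by fun_prop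
  exact (isClosed_le continuous_const h0).inter
    ((isClosed_le continuous_const h1).inter (isClosed_le (h0.add h1) continuous_const))

theorem hull_eq_image (a b c : Plane) :
    hull {a, b, c} = triMap a b c '' refTri := by
  refine Set.Subset.antisymm ?_ ?_
  · refine convexHull_min ?_ ?_
    · intro x hx
      simp only [Finset.coe_insert, Finset.coe_singleton, Set.mem_insert_iff,
        Set.mem_singleton_iff] at hx
      rcases hx with rfl | rfl | rfl
      · exact ⟨0, by simp [refTri], by simp [triMap]⟩
      · exact ⟨!₂[1, 0], by simp [refTri], by simp [triMap]⟩
      · exact ⟨!₂[0, 1], by simp [refTri], by simp [triMap]⟩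
    · have : triMap a b c '' refTri = (fun y => a + y) '' (colMap (b - a) (c - a) '' refTri) := by
        rw [← Set.image_comp]; rfl
      rw [this]
      exact (convex_refTri.linear_image (colMap (b - a) (c - a)).toLinearMap).translate a
  · rintro _ ⟨x, ⟨h0, h1, h2⟩, rfl⟩
    have hx : triMap a b c x = ∑ i : Fin 3, (![1 - x 0 - x 1, x 0, x 1] i) • (![a, b, c] i) := by
      simp [Fin.sum_univ_three, triMap]; module
    rw [hx]
    refine (convex_convexHull ℝ _).sum_mem ?_ ?_ ?_
    · intro i _; fin_cases i <;> simp <;> linarith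
    · simp [Fin.sum_univ_three]; ring
    · intro i _
      refine subset_convexHull ℝ _ ?_
      fin_cases i <;> simp

/-- The integral over a triangle as an integral over the reference triangle. -/
theorem intElem_eq {a b c : Plane} (h : cross (b - a) (c - a) ≠ 0)
    (g : Plane → ℝ) :
    intElem {a, b, c} g = |cross (b - a) (c - a)| * ∫ x in refTri, g (triMap a b c x) := by
  rw [intElem, hull_eq_image]
  rw [integral_image_eq_integral_abs_det_fderiv_smul volume isClosed_refTri.measurableSet
    (f' := fun _ => colMap (b - a) (c - a)) (fun x _ => ?_) (triMap_injective h).injOn,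
    ← integral_const_mul]
  · simp only [colMap_det, smul_eq_mul]
  · exact ((colMap (b - a) (c - a)).hasFDerivAt.const_add a).hasFDerivWithinAt

theorem isCompact_hull (K : Simp) : IsCompact (hull K) := K.finite_toSet.isCompact_convexHull ℝ

theorem isCompact_refTri : IsCompact refTri := by
  classical
  have h : cross (!₂[(1 : ℝ), 0] - 0 : Plane) (!₂[(0 : ℝ), 1] - 0) ≠ 0 := by simp [cross]
  have := hull_eq_image 0 !₂[1, 0] !₂[0, 1]
  have hid : triMap 0 !₂[1, 0] !₂[0, 1] = id := by
    funext x; ext i; fin_cases i <;> simp [triMap]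
  rw [hid, Set.image_id] at this
  rw [← this]
  exact isCompact_hull _

/-- Fubini's theorem on the reference triangle. -/
theorem integral_refTri {g : Plane → ℝ} (hg : Continuous g) :
    ∫ x in refTri, g x = ∫ s in (0 : ℝ)..1, ∫ t in (0 : ℝ)..(1 - s), g !₂[s, t] := by
  have hmp : MeasurePreserving (fun z : ℝ × ℝ => (!₂[z.1, z.2] : Plane)) volume volume := by
    have h1 := (volume_preserving_finTwoArrow ℝ).symm
    have h2 := PiLp.volume_preserving_toLp (Fin 2)
    exact h2.comp h1
  have hemb : MeasurableEmbedding (fun z : ℝ × ℝ => (!₂[z.1, z.2] : Plane)) :=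
    (MeasurableEquiv.toLp 2 (Fin 2 → ℝ)).measurableEmbedding.comp
      MeasurableEquiv.finTwoArrow.symm.measurableEmbedding
  have hcont : Continuous (fun z : ℝ × ℝ => (!₂[z.1, z.2] : Plane)) :=
    (PiLp.continuous_toLp 2 _).comp (by fun_prop)
  rw [← hmp.setIntegral_preimage_emb hemb]
  set R := (fun z : ℝ × ℝ => (!₂[z.1, z.2] : Plane)) ⁻¹' refTri with hR
  have hRm : MeasurableSet R := hcont.measurable isClosed_refTri.measurableSet
  have hmem : ∀ s t : ℝ, (s, t) ∈ R ↔ 0 ≤ s ∧ 0 ≤ t ∧ s + t ≤ 1 := fun s t => by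
    simp [hR, refTri]
  have hint : Integrable (R.indicator fun z : ℝ × ℝ => g !₂[z.1, z.2]) (volume.prod volume) := by
    rw [integrable_indicator_iff hRm]
    have := (hg.continuousOn (s := refTri)).integrableOn_compact (μ := volume) isCompact_refTri
    exact (hmp.integrableOn_comp_preimage hemb).mpr this
  rw [← integral_indicator hRm]
  change ∫ z, _ ∂(volume.prod volume) = _
  rw [integral_prod _ hint, intervalIntegral.integral_of_le zero_le_one,
    ← integral_Icc_eq_integral_Ioc, ← integral_indicator measurableSet_Icc]
  congr 1
  funext s
  by_cases hs : s ∈ Set.Icc (0 : ℝ) 1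
  · rw [Set.indicator_of_mem hs, intervalIntegral.integral_of_le (by linarith [hs.2]),
      ← integral_Icc_eq_integral_Ioc, ← integral_indicator measurableSet_Icc]
    congr 1
    funext t
    have : (s, t) ∈ R ↔ t ∈ Set.Icc 0 (1 - s) := by
      rw [hmem, Set.mem_Icc]
      constructor
      · rintro ⟨_, h1, h2⟩; exact ⟨h1, by linarith⟩
      · rintro ⟨h1, h2⟩; exact ⟨hs.1, h1, by linarith⟩
    by_cases ht : t ∈ Set.Icc 0 (1 - s)
    · rw [Set.indicator_of_mem (this.mpr ht), Set.indicator_of_mem ht]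
    · rw [Set.indicator_of_notMem (fun h => ht (this.mp h)), Set.indicator_of_notMem ht]
  · rw [Set.indicator_of_notMem hs]
    refine integral_eq_zero_of_ae (Eventually.of_forall fun t => ?_)
    refine Set.indicator_of_notMem (fun h => hs ?_) _
    have := (hmem s t).mp h
    exact ⟨this.1, by linarith [this.2.1, this.2.2]⟩

theorem meshSize_sq {a b c : Plane} (h : cross (b - a) (c - a) ≠ 0) :
    meshSize {a, b, c} ^ 2 = |cross (b - a) (c - a)| / 2 := by
  have h1 := intElem_eq h (fun _ => 1)
  rw [integral_refTri continuous_const] at h1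
  rw [meshSize, Real.sq_sqrt measureReal_nonneg]
  have h2 : intElem {a, b, c} (fun _ => 1) = volume.real (hull {a, b, c}) := by simp [intElem]
  have h3 : ∫ s in (0 : ℝ)..1, (1 - s) = 1 / 2 := by
    rw [intervalIntegral.integral_sub (by simp) (by simp)]
    norm_num
  rw [← h2, h1]
  simp only [intervalIntegral.integral_const, sub_zero, smul_eq_mul, mul_one, h3]
  ring

/-- The integral over an edge as an integral over the unit interval. -/
theorem intEdge_eq {a b : Plane} (hab : a ≠ b) (g : Plane → ℝ) :
    intEdge {a, b} g = ‖b - a‖ * ∫ s in (0 : ℝ)..1, g (a + s • (b - a)) := by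
  have hl : 0 < ‖b - a‖ := norm_pos_iff.mpr (sub_ne_zero.mpr hab.symm)
  set l := ‖b - a‖ with hl'
  set w := l⁻¹ • (b - a) with hw
  have hwn : ‖w‖ = 1 := by rw [hw, norm_smul, norm_inv, norm_norm, inv_mul_cancel₀ hl.ne']
  have hiso : Isometry (fun s : ℝ => a + s • w) := by
    refine Isometry.of_dist_eq fun s t => ?_
    rw [dist_add_left, dist_eq_norm, ← sub_smul, norm_smul, hwn, mul_one, Real.dist_eq,
      Real.norm_eq_abs]
  have hmap := hiso.map_hausdorffMeasure (d := 1) (Or.inl zero_le_one)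
  rw [hausdorffMeasure_real] at hmap
  have hemb : MeasurableEmbedding (fun s : ℝ => a + s • w) :=
    hiso.isClosedEmbedding.measurableEmbedding
  have himg : hull {a, b} = (fun s : ℝ => a + s • w) '' Set.Icc 0 l := by
    rw [hull, Finset.coe_insert, Finset.coe_singleton, convexHull_pair, segment_eq_image']
    ext x
    constructor
    · rintro ⟨s, hs, rfl⟩
      refine ⟨s * l, ⟨by have := hs.1; positivity, by nlinarith [hs.2]⟩, ?_⟩
      simp only [hw, smul_smul]
      rw [mul_assoc, mul_inv_cancel₀ hl.ne', mul_one]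
    · rintro ⟨s, hs, rfl⟩
      refine ⟨s / l, ⟨by have := hs.1; positivity, by rw [div_le_one hl]; exact hs.2⟩, ?_⟩
      simp only [hw, smul_smul]
      rw [div_eq_mul_inv]
  have hsub : hull {a, b} ⊆ Set.range (fun s : ℝ => a + s • w) := by
    rw [himg]; exact Set.image_subset_range _ _
  have hmeas : (Measure.hausdorffMeasure 1).restrict (hull {a, b}) =
      (Measure.map (fun s : ℝ => a + s • w) volume).restrict (hull {a, b}) := by
    rw [hmap, Measure.restrict_restrict_of_subset hsub]
  rw [intEdge, hmeas, hemb.setIntegral_map]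
  have hpre : (fun s : ℝ => a + s • w) ⁻¹' hull {a, b} = Set.Icc 0 l := by
    rw [himg, Set.preimage_image_eq _ hiso.injective]
  rw [hpre, integral_Icc_eq_integral_Ioc, ← intervalIntegral.integral_of_le hl.le]
  have := intervalIntegral.mul_integral_comp_mul_left (a := 0) (b := 1)
    (f := fun s => g (a + s • w)) l
  rw [mul_zero, mul_one] at this
  rw [← this]
  congr 1
  refine intervalIntegral.integral_congr fun s _ => ?_
  simp only [hw, smul_smul]
  rw [mul_comm l s, mul_assoc, mul_inv_cancel₀ hl.ne', mul_one]

theorem integrableOn_hull {g : Plane → ℝ} (hg : Continuous g) (K : Simp) :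
    IntegrableOn g (hull K) :=
  hg.continuousOn.integrableOn_compact (isCompact_hull K)

/-! ### Labeled triangles and their normals -/

/-- The vertices of the triangle `K` are listed as `a`, `b`, `c`. -/
structure IsLabeling (K : Simp) (a b c : Plane) : Prop where
  triangle : IsTriangle K
  eq : K = {a, b, c}
  cross_ne : cross (b - a) (c - a) ≠ 0

theorem exists_isLabeling_of_mem_edges {K e : Simp} (hK : IsTriangle K) (he : e ∈ edges K) :
    ∃ a b c, IsLabeling K a b c ∧ e = {a, b} := by
  obtain ⟨a, b, c, -, hKs, hes, hne⟩ := triangle_vertices hK he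
  exact ⟨a, b, c, ⟨hK, hKs, by rwa [inner_rot] at hne⟩, hes⟩

theorem edges_nonempty {K : Simp} (hK : IsTriangle K) : (edges K).Nonempty := by
  rw [edges, Finset.powersetCard_nonempty, hK.1]; norm_num

theorem exists_isLabeling {K : Simp} (hK : IsTriangle K) : ∃ a b c, IsLabeling K a b c := by
  obtain ⟨e, he⟩ := edges_nonempty hK
  obtain ⟨a, b, c, h, -⟩ := exists_isLabeling_of_mem_edges hK he
  exact ⟨a, b, c, h⟩

namespace IsLabeling

variable {K : Simp} {a b c : Plane}

theorem swap (h : IsLabeling K a b c) : IsLabeling K a c b where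
  triangle := h.triangle
  eq := by rw [h.eq, Finset.pair_comm]
  cross_ne := fun h0 => h.cross_ne (by simp only [cross] at *; linarith)

theorem rotate (h : IsLabeling K a b c) : IsLabeling K b c a where
  triangle := h.triangle
  eq := by
    rw [h.eq]; ext x
    simp only [Finset.mem_insert, Finset.mem_singleton]; tauto
  cross_ne := fun h0 => h.cross_ne (by
    simp only [cross, PiLp.sub_apply] at *; linarith)

theorem abs_cross_rotate (a b c : Plane) :
    |cross (c - b) (a - b)| = |cross (b - a) (c - a)| := by
  congr 1; simp only [cross, PiLp.sub_apply]; ring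

theorem ne (h : IsLabeling K a b c) : a ≠ b := by
  rintro rfl
  exact h.cross_ne (by simp [cross])

theorem mem_edges (h : IsLabeling K a b c) : {a, b} ∈ edges K := by
  rw [edges, Finset.mem_powersetCard]
  refine ⟨?_, Finset.card_pair h.ne⟩
  rw [h.eq]
  intro x; simp only [Finset.mem_insert, Finset.mem_singleton]; tauto

theorem edges_eq (h : IsLabeling K a b c) :
    edges K = {{a, b}, {a, c}, {b, c}} := by
  have hab := h.ne
  have hac := h.swap.ne
  have hbc := h.rotate.ne
  symm
  refine Finset.eq_of_subset_of_card_le ?_ ?_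
  · intro e he
    simp only [Finset.mem_insert, Finset.mem_singleton] at he
    rcases he with rfl | rfl | rfl
    · exact h.mem_edges
    · exact h.swap.mem_edges
    · exact h.rotate.mem_edges
  · rw [edges, Finset.card_powersetCard, h.triangle.1]
    have h1 : ({a, b} : Simp) ≠ {a, c} := fun h' => by
      have : b ∈ ({a, c} : Simp) := h' ▸ by simp
      simp only [Finset.mem_insert, Finset.mem_singleton] at this; tauto
    have h2 : ({a, b} : Simp) ≠ {b, c} := fun h' => by
      have : a ∈ ({b, c} : Simp) := h' ▸ by simp
      simp only [Finset.mem_insert, Finset.mem_singleton] at this; tauto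
    have h3 : ({a, c} : Simp) ≠ {b, c} := fun h' => by
      have : a ∈ ({b, c} : Simp) := h' ▸ by simp
      simp only [Finset.mem_insert, Finset.mem_singleton] at this; tauto
    rw [Finset.card_eq_three.mpr ⟨_, _, _, h1, h2, h3, rfl⟩]
    decide

theorem sum_edges (h : IsLabeling K a b c) (f : Simp → ℝ) :
    ∑ e ∈ edges K, f e = f {a, b} + f {a, c} + f {b, c} := by
  have hab := h.ne
  have hac := h.swap.ne
  have hbc := h.rotate.ne
  rw [h.edges_eq, Finset.sum_insert, Finset.sum_insert, Finset.sum_singleton, add_assoc]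
  · simp only [Finset.mem_singleton]
    intro h'
    have : a ∈ ({b, c} : Simp) := h' ▸ by simp
    simp only [Finset.mem_insert, Finset.mem_singleton] at this; tauto
  · simp only [Finset.mem_insert, Finset.mem_singleton]
    rintro (h' | h')
    · have : b ∈ ({a, c} : Simp) := h' ▸ by simp
      simp only [Finset.mem_insert, Finset.mem_singleton] at this; tauto
    · have : a ∈ ({b, c} : Simp) := h' ▸ by simp
      simp only [Finset.mem_insert, Finset.mem_singleton] at this; tauto

end IsLabeling

/-- A unit normal of an edge is a multiple of the rotated edge vector. -/
theorem IsUnitNormal.exists_eq_smul {a b n : Plane} (hab : a ≠ b) (hn : IsUnitNormal {a, b} n) :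
    ∃ α : ℝ, n = α • rot (b - a) ∧ α ^ 2 * ‖b - a‖ ^ 2 = 1 := by
  obtain ⟨h1, h2⟩ := hn
  have h3 := h2 b (by simp) a (by simp)
  rw [inner_eq] at h3
  have hl : ‖b - a‖ ^ 2 ≠ 0 := by
    have := norm_pos_iff.mpr (sub_ne_zero.mpr hab.symm)
    positivity
  have hn1 : n 0 ^ 2 + n 1 ^ 2 = 1 := by rw [← plane_norm_sq, h1, one_pow]
  set u := b - a
  rw [plane_norm_sq] at *
  have key : n = ((n 1 * u 0 - n 0 * u 1) / (u 0 ^ 2 + u 1 ^ 2)) • rot u := by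
    ext i
    fin_cases i
    · simp [rot]; field_simp; linear_combination (u 0) * h3
    · simp [rot]; field_simp; linear_combination (u 1) * h3
  refine ⟨_, key, ?_⟩
  field_simp
  linear_combination (u 0 ^ 2 + u 1 ^ 2) * hn1 - (n 0 * u 0 + n 1 * u 1) * h3

theorem isUnitNormal_outNormal {K e : Simp} (hK : IsTriangle K) (he : e ∈ edges K) :
    IsUnitNormal e (outNormal K e) := (outNormal_spec hK he).1

/-- Two unit normals of an edge agree up to the sign `n · m`. -/
theorem IsUnitNormal.eq_smul {K e : Simp} (hK : IsTriangle K) (he : e ∈ edges K) {n m : Plane}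
    (hn : IsUnitNormal e n) (hm : IsUnitNormal e m) :
    m = (inner ℝ n m : ℝ) • n ∧ (inner ℝ n m : ℝ) ^ 2 = 1 := by
  obtain ⟨a, b, c, hL, rfl⟩ := exists_isLabeling_of_mem_edges hK he
  obtain ⟨α, rfl, hα⟩ := hn.exists_eq_smul hL.ne
  obtain ⟨β, rfl, hβ⟩ := hm.exists_eq_smul hL.ne
  have h1 : (inner ℝ (α • rot (b - a)) (β • rot (b - a)) : ℝ) = α * β * ‖b - a‖ ^ 2 := by
    rw [inner_eq, plane_norm_sq]; simp [rot]; ring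
  rw [h1, smul_smul]
  constructor
  · congr 1; linear_combination (-β) * hα
  · linear_combination β ^ 2 * ‖b - a‖ ^ 2 * hα + hβ

/-- The distance of the opposite vertex from an edge, in terms of the outward normal. -/
theorem IsLabeling.inner_outNormal {K : Simp} {a b c : Plane} (h : IsLabeling K a b c) :
    ‖b - a‖ * inner ℝ (outNormal K {a, b}) (c - a) = -|cross (b - a) (c - a)| := by
  have hs := outNormal_spec h.triangle h.mem_edges
  have hneg := hs.2 c (by simp [h.eq]) (by
    have := h.swap.ne
    have := h.rotate.ne
    simp only [Finset.mem_insert, Finset.mem_singleton]; tauto) a (by simp)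
  obtain ⟨α, hn, hα⟩ := hs.1.exists_eq_smul h.ne
  rw [hn, inner_smul_left, inner_rot, conj_trivial] at hneg ⊢
  rw [← abs_of_pos (norm_pos_iff.mpr (sub_ne_zero.mpr h.ne.symm)), ← neg_eq_iff_eq_neg,
    ← mul_neg, ← abs_of_pos (neg_pos.mpr hneg), ← abs_mul, ← sq_eq_sq₀ (abs_nonneg _)
    (abs_nonneg _), sq_abs, sq_abs]
  linear_combination (cross (b - a) (c - a)) ^ 2 * hα

/-! ### The divergence theorem on a triangle -/

theorem continuous_inner_grad (p : Poly) (v : Plane) :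
    Continuous fun x => (inner ℝ v (grad p x) : ℝ) :=
  Continuous.inner continuous_const (continuous_grad p)

theorem intElem_inner_grad {K : Simp} {a b c : Plane} (h : IsLabeling K a b c) (p : Poly) :
    intElem K (fun x => inner ℝ (c - a) (grad p x)) =
      |cross (b - a) (c - a)| * ((∫ s in (0 : ℝ)..1, ev p (c + s • (b - c))) -
        ∫ s in (0 : ℝ)..1, ev p (a + s • (b - a))) := by
  have hc := continuous_inner_grad p (c - a)
  rw [h.eq, intElem_eq h.cross_ne,
    integral_refTri (g := fun x => inner ℝ (c - a) (grad p (triMap a b c x)))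
      (hc.comp (continuous_triMap a b c))]
  congr 1
  have hi : ∀ x y : Plane, IntervalIntegrable (fun s : ℝ => ev p (x + s • y)) volume 0 1 :=
    fun x y => Continuous.intervalIntegrable ((continuous_ev p).comp (by fun_prop)) _ _
  rw [← intervalIntegral.integral_sub (hi _ _) (hi _ _)]
  refine intervalIntegral.integral_congr fun s _ => ?_
  have hpt : ∀ t : ℝ, triMap a b c !₂[s, t] = (a + s • (b - a)) + t • (c - a) := fun t => by
    simp [triMap, add_assoc]
  simp only [hpt]
  have hFTC := intervalIntegral.integral_eq_sub_of_hasDerivAt (a := 0) (b := 1 - s)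
    (fun t _ => hasDerivAt_ev_line p (a + s • (b - a)) (c - a) t)
    (Continuous.intervalIntegrable (hc.comp (by fun_prop)) _ _)
  rw [hFTC]
  congr 2
  · module
  · simp

theorem intBdry_mul_inner_edge {K : Simp} {a b c : Plane} (h : IsLabeling K a b c) (p : Poly) :
    intBdry K (fun e x => ev p x * inner ℝ (outNormal K e) (c - a)) =
      |cross (b - a) (c - a)| * ((∫ s in (0 : ℝ)..1, ev p (c + s • (b - c))) -
        ∫ s in (0 : ℝ)..1, ev p (a + s • (b - a))) := by
  rw [intBdry, h.sum_edges]
  have e0 : ∀ {x y : Plane}, x ≠ y → ∀ r : ℝ, intEdge {x, y} (fun z => ev p z * r) =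
      (∫ s in (0 : ℝ)..1, ev p (x + s • (y - x))) * (‖y - x‖ * r) := by
    intro x y hxy r
    rw [intEdge_eq hxy, intervalIntegral.integral_mul_const]; ring
  rw [e0 h.ne, h.inner_outNormal, e0 h.swap.ne]
  have h2 : (inner ℝ (outNormal K {a, c}) (c - a) : ℝ) = 0 :=
    (isUnitNormal_outNormal h.triangle h.swap.mem_edges).2 c (by simp) a (by simp)
  have h4 := h.rotate.inner_outNormal
  have h5 : (inner ℝ (outNormal K {b, c}) (c - a) : ℝ) =
      - inner ℝ (outNormal K {b, c}) (a - b) := by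
    have := (isUnitNormal_outNormal h.triangle h.rotate.mem_edges).2 c (by simp) b (by simp)
    have e : c - a = (c - b) - (a - b) := by abel
    rw [e, inner_sub_right, this, zero_sub]
  have hbc : ({b, c} : Simp) = {c, b} := Finset.pair_comm _ _
  have h6 : intEdge {b, c} (fun x => ev p x * inner ℝ (outNormal K {b, c}) (c - a)) =
      (∫ s in (0 : ℝ)..1, ev p (c + s • (b - c))) * |cross (b - a) (c - a)| := by
    conv_lhs => rw [h5]
    conv_lhs => arg 1; rw [hbc]
    rw [e0 h.rotate.ne.symm, norm_sub_rev, mul_neg, h4, neg_neg,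
      IsLabeling.abs_cross_rotate]
  rw [h6, h2]
  ring

theorem intElem_add {K : Simp} {f g : Plane → ℝ} (hf : Continuous f) (hg : Continuous g) :
    intElem K (fun x => f x + g x) = intElem K f + intElem K g :=
  integral_add (integrableOn_hull hf K) (integrableOn_hull hg K)

theorem intElem_const_mul {K : Simp} (r : ℝ) (f : Plane → ℝ) :
    intElem K (fun x => r * f x) = r * intElem K f := integral_const_mul _ _

theorem hausdorffMeasure_edge_lt_top {K e : Simp} (hK : IsTriangle K) (he : e ∈ edges K) :
    (Measure.hausdorffMeasure (X := Plane) 1) (hull e) < ⊤ := by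
  obtain ⟨a, b, c, -, rfl⟩ := exists_isLabeling_of_mem_edges hK he
  rw [hull, Finset.coe_insert, Finset.coe_singleton, convexHull_pair, hausdorffMeasure_segment]
  exact edist_lt_top _ _

theorem integrableOn_edge {K e : Simp} (hK : IsTriangle K) (he : e ∈ edges K) {g : Plane → ℝ}
    (hg : Continuous g) : IntegrableOn g (hull e) (Measure.hausdorffMeasure 1) := by
  have : IsFiniteMeasure ((Measure.hausdorffMeasure (X := Plane) 1).restrict (hull e)) :=
    ⟨by rw [Measure.restrict_apply_univ]; exact hausdorffMeasure_edge_lt_top hK he⟩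
  obtain ⟨C, hC⟩ := (isCompact_hull e).exists_bound_of_continuousOn hg.continuousOn
  exact Integrable.of_bound hg.aestronglyMeasurable C
    ((ae_restrict_iff' (isCompact_hull e).measurableSet).mpr (Filter.Eventually.of_forall hC))

theorem intBdry_add {K : Simp} (hK : IsTriangle K) {f g : Simp → Plane → ℝ}
    (hf : ∀ e, Continuous (f e)) (hg : ∀ e, Continuous (g e)) :
    intBdry K (fun e x => f e x + g e x) = intBdry K f + intBdry K g := by
  rw [intBdry, intBdry, intBdry, ← Finset.sum_add_distrib]
  exact Finset.sum_congr rfl fun e he =>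
    integral_add (integrableOn_edge hK he (hf e)) (integrableOn_edge hK he (hg e))

theorem intBdry_const_mul {K : Simp} (r : ℝ) (f : Simp → Plane → ℝ) :
    intBdry K (fun e x => r * f e x) = r * intBdry K f := by
  rw [intBdry, intBdry, Finset.mul_sum]
  exact Finset.sum_congr rfl fun e _ => integral_const_mul _ _

theorem intBdry_congr {K : Simp} {f g : Simp → Plane → ℝ} (h : ∀ e ∈ edges K, ∀ x, f e x = g e x) :
    intBdry K f = intBdry K g :=
  Finset.sum_congr rfl fun e he => congrArg _ (funext (h e he))

/-- The Gauss theorem for a polynomial and a constant direction. -/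
theorem intElem_inner_grad_eq_intBdry {K : Simp} (hK : IsTriangle K) (p : Poly) (d : Plane) :
    intElem K (fun x => inner ℝ d (grad p x)) =
      intBdry K (fun e x => ev p x * inner ℝ (outNormal K e) d) := by
  obtain ⟨a, b, c, h⟩ := exists_isLabeling hK
  have hc := (intElem_inner_grad h p).trans (intBdry_mul_inner_edge h p).symm
  have hb := (intElem_inner_grad h.swap p).trans (intBdry_mul_inner_edge h.swap p).symm
  have hD := h.cross_ne
  obtain ⟨s, t, rfl⟩ : ∃ s t : ℝ, d = s • (b - a) + t • (c - a) := by
    refine ⟨cross d (c - a) / cross (b - a) (c - a), cross (b - a) d / cross (b - a) (c - a), ?_⟩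
    ext i
    simp only [PiLp.add_apply, PiLp.smul_apply, smul_eq_mul]
    field_simp
    fin_cases i <;> simp [cross] <;> ring
  have h1 : ∀ x, (inner ℝ (s • (b - a) + t • (c - a)) (grad p x) : ℝ) =
      s * inner ℝ (b - a) (grad p x) + t * inner ℝ (c - a) (grad p x) := fun x => by
    rw [inner_add_left, inner_smul_left, inner_smul_left]; rfl
  have h2 : ∀ (e : Simp) (x : Plane),
      ev p x * (inner ℝ (outNormal K e) (s • (b - a) + t • (c - a)) : ℝ) =
      s * (ev p x * inner ℝ (outNormal K e) (b - a)) +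
        t * (ev p x * inner ℝ (outNormal K e) (c - a)) := fun e x => by
    rw [inner_add_right, inner_smul_right, inner_smul_right]; ring
  simp only [h1, h2]
  have hcp := continuous_ev p
  rw [intElem_add ((continuous_inner_grad p _).const_mul s)
      ((continuous_inner_grad p _).const_mul t),
    intElem_const_mul, intElem_const_mul,
    intBdry_add hK (fun e => (hcp.mul_const _).const_mul s)
      (fun e => (hcp.mul_const _).const_mul t),
    intBdry_const_mul, intBdry_const_mul, hb, hc]

/-! ### Polynomial tensors -/

theorem evT_apply (τ : PolyTensor) (x : Plane) (i j : Fin 2) : evT τ x i j = ev (τ i j) x := rfl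

theorem evT_sub (σ τ : PolyTensor) (x : Plane) : evT (σ - τ) x = evT σ x - evT τ x := by
  ext i j; simp [evT]

@[simp] theorem evT_zero (x : Plane) : evT 0 x = 0 := by
  ext i j; simp [evT]

/-- The polynomial `aᵀ τ b`. -/
def bilPoly (a : Plane) (τ : PolyTensor) (b : Plane) : Poly := ∑ i, ∑ j, (a i * b j) • τ i j

theorem ev_bilPoly (a : Plane) (τ : PolyTensor) (b : Plane) (x : Plane) :
    ev (bilPoly a τ b) x = bil a (evT τ x) b := by
  simp only [bilPoly, bil, ev_sum, ev_smul, evT_apply]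
  exact Finset.sum_congr rfl fun i _ => Finset.sum_congr rfl fun j _ => by ring

theorem bilPoly_mem {r : ℤ} {τ : PolyTensor} (h : τ ∈ symPolySpace r) (a b : Plane) :
    bilPoly a τ b ∈ polySpace r :=
  Submodule.sum_mem _ fun i _ => Submodule.sum_mem _ fun j _ => Submodule.smul_mem _ _ (h.2 i j)

/-- The polynomial `σ : τ`. -/
def frobPoly (σ τ : PolyTensor) : Poly := ∑ i, ∑ j, σ i j * τ i j

theorem ev_frobPoly (σ τ : PolyTensor) (x : Plane) :
    ev (frobPoly σ τ) x = frob (evT σ x) (evT τ x) := by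
  simp [frobPoly, frob, evT_apply]

theorem continuous_frob (σ τ : PolyTensor) : Continuous fun x => frob (evT σ x) (evT τ x) := by
  simpa only [← ev_frobPoly] using continuous_ev (frobPoly σ τ)

theorem continuous_bil (τ : PolyTensor) (a b : Plane) :
    Continuous fun x => bil a (evT τ x) b := by
  simpa only [← ev_bilPoly] using continuous_ev (bilPoly a τ b)

theorem sub_mem_symPolySpace {r : ℤ} {σ τ : PolyTensor} (hσ : σ ∈ symPolySpace r)
    (hτ : τ ∈ symPolySpace r) : σ - τ ∈ symPolySpace r :=
  ⟨hσ.1.sub hτ.1, fun i j => Submodule.sub_mem _ (hσ.2 i j) (hτ.2 i j)⟩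

/-- The operator `𝒞` with the Poisson ratio `c` on polynomial tensors. -/
def cOpPoly (c : ℝ) (τ : PolyTensor) : PolyTensor :=
  (1 / (1 - c)) • τ - Matrix.diagonal fun _ => (c / (1 - c ^ 2)) • τ.trace

theorem evT_cOpPoly (c : ℝ) (τ : PolyTensor) (x : Plane) :
    evT (cOpPoly c τ) x = cOp c (evT τ x) := by
  ext i j
  fin_cases i <;> fin_cases j <;>
    simp [cOpPoly, cOp, evT, Matrix.trace, Matrix.diagonal, mul_add]

theorem cOpPoly_sub (c : ℝ) (σ τ : PolyTensor) :
    cOpPoly c (σ - τ) = cOpPoly c σ - cOpPoly c τ := by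
  ext1 i j
  fin_cases i <;> fin_cases j <;> simp [cOpPoly, Matrix.trace, Matrix.diagonal] <;> module

/-- The Hessian of a polynomial. -/
def hessPoly (u : Poly) : PolyTensor :=
  Matrix.of fun i j => MvPolynomial.pderiv j (MvPolynomial.pderiv i u)

theorem pderiv_pderiv_comm (u : Poly) (i j : Fin 2) :
    MvPolynomial.pderiv i (MvPolynomial.pderiv j u) =
      MvPolynomial.pderiv j (MvPolynomial.pderiv i u) := by
  have h : ⁅(MvPolynomial.pderiv i : Derivation ℝ Poly Poly),
      (MvPolynomial.pderiv j : Derivation ℝ Poly Poly)⁆ = 0 := by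
    refine MvPolynomial.derivation_ext fun l => ?_
    rw [Derivation.commutator_apply]
    simp [MvPolynomial.pderiv_X, Pi.single_apply]
    split_ifs <;> simp
  have := congrArg (fun D => D u) h
  simp only [Derivation.commutator_apply, Derivation.coe_zero, Pi.zero_apply] at this
  exact sub_eq_zero.mp this

theorem hessPoly_mem {r : ℤ} {u : Poly} (hu : u ∈ polySpace r) :
    hessPoly u ∈ symPolySpace (r - 2) := by
  refine ⟨Matrix.IsSymm.ext fun i j => pderiv_pderiv_comm u i j, fun i j => ?_⟩
  have := pderiv_mem_polySpace (pderiv_mem_polySpace hu i) j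
  rwa [sub_sub, one_add_one_eq_two] at this

/-- Green's formula for the bending moment: the boundary term of the row-wise divergence, split into
its normal and its tangential part. -/
theorem green_formula {K : Simp} (hK : IsTriangle K) (τ : PolyTensor) (u : Poly) :
    - intElem K (fun x => inner ℝ (divT τ x) (grad u x)) +
      intBdry K (fun e x => bil (rot (outNormal K e)) (evT τ x) (outNormal K e) *
        inner ℝ (rot (outNormal K e)) (grad u x)) =
    intElem K (fun x => frob (evT (hessPoly u) x) (evT τ x)) -
      intBdry K (fun e x => bil (outNormal K e) (evT τ x) (outNormal K e) *
        inner ℝ (outNormal K e) (grad u x)) := by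
  -- the Gauss theorem for the vector field `τᵀ ∇u`
  let Φ : Fin 2 → Poly := fun j => ∑ i, τ i j * MvPolynomial.pderiv i u
  have hG := fun j => intElem_inner_grad_eq_intBdry hK (Φ j) (EuclideanSpace.single j 1)
  have hcg : ∀ j, Continuous fun x =>
      (inner ℝ (EuclideanSpace.single j 1) (grad (Φ j) x) : ℝ) := fun j =>
    continuous_inner_grad _ _
  have hcb : ∀ j (e : Simp), Continuous fun x =>
      ev (Φ j) x * (inner ℝ (outNormal K e) (EuclideanSpace.single j 1) : ℝ) := fun j e =>
    (continuous_ev _).mul_const _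
  have hsum := congrArg₂ (· + ·) (hG 0) (hG 1)
  rw [← intElem_add (hcg 0) (hcg 1), ← intBdry_add hK (hcb 0) (hcb 1)] at hsum
  have hdiv : Continuous fun x => (inner ℝ (divT τ x) (grad u x) : ℝ) := by
    refine Continuous.inner ?_ (continuous_grad u)
    refine (PiLp.continuous_toLp 2 _).comp (continuous_pi fun i => ?_)
    exact continuous_finsetSum _ fun j _ => continuous_ev _
  have h1 : ∀ x, (inner ℝ (EuclideanSpace.single 0 1) (grad (Φ 0) x) : ℝ) +
      inner ℝ (EuclideanSpace.single 1 1) (grad (Φ 1) x) =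
      inner ℝ (divT τ x) (grad u x) + frob (evT (hessPoly u) x) (evT τ x) := fun x => by
    simp [inner_eq, grad, divT, Φ, frob, Fin.sum_univ_two, Derivation.leibniz, evT, hessPoly]
    ring
  have h2 : ∀ e ∈ edges K, ∀ x,
      ev (Φ 0) x * (inner ℝ (outNormal K e) (EuclideanSpace.single 0 1) : ℝ) +
        ev (Φ 1) x * inner ℝ (outNormal K e) (EuclideanSpace.single 1 1) =
      bil (rot (outNormal K e)) (evT τ x) (outNormal K e) *
        inner ℝ (rot (outNormal K e)) (grad u x) +
      bil (outNormal K e) (evT τ x) (outNormal K e) *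
        inner ℝ (outNormal K e) (grad u x) := fun e he x => by
    have hn : (outNormal K e) 0 ^ 2 + (outNormal K e) 1 ^ 2 = 1 := by
      rw [← plane_norm_sq, (isUnitNormal_outNormal hK he).1, one_pow]
    simp [inner_eq, grad, Φ, bil, rot, Fin.sum_univ_two, evT]
    set n := outNormal K e
    linear_combination (-((ev (τ 0 0) x * n 0 + ev (τ 0 1) x * n 1) *
      ev (MvPolynomial.pderiv 0 u) x + (ev (τ 1 0) x * n 0 + ev (τ 1 1) x * n 1) *
      ev (MvPolynomial.pderiv 1 u) x)) * hn
  have hcm : ∀ a : Plane → Plane, ∀ e : Simp, Continuous fun x =>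
      bil (a (outNormal K e)) (evT τ x) (outNormal K e) *
        (inner ℝ (a (outNormal K e)) (grad u x) : ℝ) := fun a e =>
    (continuous_bil τ _ _).mul (continuous_inner_grad u _)
  simp only [h1] at hsum
  rw [intBdry_congr h2, intElem_add hdiv (continuous_frob _ _),
    intBdry_add hK (hcm rot) (hcm fun n => n)] at hsum
  linarith

/-! ### Triangulations and integrals over the domain -/

theorem convex_hull (K : Simp) : Convex ℝ (hull K) := convex_convexHull ℝ _

theorem interior_hull_eq_empty {s : Simp} (hs : s.card ≤ 2) : interior (hull s) = ∅ := by
  by_contra h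
  rw [← Ne, ← Set.nonempty_iff_ne_empty, hull,
    interior_convexHull_nonempty_iff_affineSpan_eq_top] at h
  rcases s.eq_empty_or_nonempty with rfl | hne
  · simp at h
  have h1 : Module.finrank ℝ (vectorSpan ℝ (s : Set Plane)) = 2 := by
    rw [← direction_affineSpan, h, AffineSubspace.direction_top, finrank_top]
    simp
  have hpos := hne.card_pos
  have := finrank_vectorSpan_range_le ℝ (fun x : s => (x : Plane)) (n := s.card - 1)
    (by rw [Fintype.card_coe]; omega)
  rw [Subtype.range_coe_subtype, Finset.setOfPred_mem, h1] at this
  omega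

theorem volume_frontier_hull (K : Simp) : volume (frontier (hull K)) = 0 :=
  (convex_hull K).addHaar_frontier volume

theorem volume_hull_eq_zero {s : Simp} (hs : s.card ≤ 2) : volume (hull s) = 0 := by
  have := volume_frontier_hull s
  rwa [frontier, (isCompact_hull s).isClosed.closure_eq, interior_hull_eq_empty hs,
    Set.sdiff_empty] at this

theorem interior_hull_ae_eq (K : Simp) : interior (hull K) =ᵐ[volume] hull K := by
  refine Filter.EventuallyLE.antisymm (Filter.Eventually.of_forall interior_subset) ?_
  rw [ae_le_set]
  have := volume_frontier_hull K
  rwa [frontier, (isCompact_hull K).isClosed.closure_eq] at this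

theorem intElem_eq_interior (K : Simp) (g : Plane → ℝ) :
    intElem K g = ∫ x in interior (hull K), g x :=
  (setIntegral_congr_set (interior_hull_ae_eq K)).symm

theorem intElem_congr {K : Simp} {f g : Plane → ℝ} (h : ∀ x ∈ interior (hull K), f x = g x) :
    intElem K f = intElem K g := by
  rw [intElem_eq_interior, intElem_eq_interior]
  exact setIntegral_congr_fun isOpen_interior.measurableSet h

theorem intElem_nonneg {K : Simp} {g : Plane → ℝ} (h : ∀ x, 0 ≤ g x) : 0 ≤ intElem K g :=
  integral_nonneg h

theorem intElem_mono {K : Simp} {f g : Plane → ℝ} (hf : Continuous f) (hg : Continuous g)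
    (h : ∀ x, f x ≤ g x) : intElem K f ≤ intElem K g :=
  integral_mono (integrableOn_hull hf K) (integrableOn_hull hg K) h

namespace IsTriangulation

variable {Ω : Set Plane} {T : Finset Simp}

theorem disjoint_interior (hT : IsTriangulation Ω T) {K L : Simp} (hK : K ∈ T) (hL : L ∈ T)
    (hne : K ≠ L) : Disjoint (interior (hull K)) (interior (hull L)) := by
  classical
  rw [Set.disjoint_iff_inter_eq_empty, ← interior_inter, hT.conforming K hK L hL,
    ← Finset.coe_inter]
  refine interior_hull_eq_empty ?_
  have h3 := (hT.triangle K hK).1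
  have h3' := (hT.triangle L hL).1
  by_contra hlt
  have h1 : K ∩ L = K := Finset.eq_of_subset_of_card_le Finset.inter_subset_left (by omega)
  have h2 : K ∩ L = L := Finset.eq_of_subset_of_card_le Finset.inter_subset_right (by omega)
  exact hne (h1.symm.trans h2)

theorem nonempty_interior (hT : IsTriangulation Ω T) {K : Simp} (hK : K ∈ T) :
    (interior (hull K)).Nonempty := by
  obtain ⟨h3, hind⟩ := hT.triangle K hK
  rw [hull, interior_convexHull_nonempty_iff_affineSpan_eq_top]
  have := hind.affineSpan_eq_top_iff_card_eq_finrank_add_one.mpr (by simp [h3])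
  simpa using this

theorem volume_frontier (hT : IsTriangulation Ω T) : volume (frontier Ω) = 0 := by
  rw [hT.boundary]
  refine (measure_biUnion_null_iff (Finset.countable_toSet _)).mpr fun e he => ?_
  refine (measure_iUnion_null fun _ => ?_)
  refine volume_hull_eq_zero ?_
  classical
  obtain ⟨K, -, heK⟩ := Finset.mem_biUnion.mp (by exact he : e ∈ T.biUnion edges)
  exact (Finset.mem_powersetCard.mp heK).2.le

theorem ae_eq_iUnion (hT : IsTriangulation Ω T) (hΩ : IsOpen Ω) :
    Ω =ᵐ[volume] ⋃ K ∈ T, interior (hull K) := by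
  -- `Ω` may be smaller than the interior of its closure, but its boundary consists of edges
  have h1 : Ω =ᵐ[volume] closure Ω := by
    refine Filter.EventuallyLE.antisymm (Filter.Eventually.of_forall subset_closure) ?_
    rw [ae_le_set]
    have := hT.volume_frontier
    rwa [frontier, hΩ.interior_eq] at this
  rw [← hT.cover] at h1
  refine h1.trans ?_
  refine (Filter.EventuallyEq.countable_bUnion (Finset.countable_toSet T) fun K _ =>
    (interior_hull_ae_eq K).symm)

/-- The integral over the domain is the sum of the integrals over the elements. -/
theorem integral_eq_sum (hT : IsTriangulation Ω T) (hΩ : IsOpen Ω) {g : Plane → ℝ}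
    (hg : ∀ K ∈ T, IntegrableOn g (interior (hull K))) :
    ∫ x in Ω, g x = ∑ K ∈ T, intElem K g := by
  rw [setIntegral_congr_set (hT.ae_eq_iUnion hΩ), integral_biUnion_finset]
  · exact Finset.sum_congr rfl fun K _ => (intElem_eq_interior K g).symm
  · exact fun K _ => isOpen_interior.measurableSet
  · exact fun K hK L hL hne => hT.disjoint_interior hK hL hne
  · exact hg

theorem tensorField_eq (hT : IsTriangulation Ω T) (τ : Simp → PolyTensor) {K : Simp} (hK : K ∈ T)
    {x : Plane} (hx : x ∈ interior (hull K)) : tensorField T τ x = evT (τ K) x := by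
  rw [tensorField, glue, Finset.sum_eq_single_of_mem K hK, Set.indicator_of_mem hx]
  intro L hL hne
  refine Set.indicator_of_notMem (fun hxL => ?_) _
  exact Set.disjoint_left.mp (hT.disjoint_interior hL hK hne) hxL hx

theorem aForm_eq_sum (hT : IsTriangulation Ω T) (hΩ : IsOpen Ω) {ν : Plane → ℝ} {c : Simp → ℝ}
    (hν : ∀ K ∈ T, ∀ x ∈ interior (hull K), ν x = c K) {F G : Plane → Tensor}
    {f g : Simp → PolyTensor} (hF : ∀ K ∈ T, ∀ x ∈ interior (hull K), F x = evT (f K) x)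
    (hG : ∀ K ∈ T, ∀ x ∈ interior (hull K), G x = evT (g K) x) :
    aForm Ω ν F G =
      ∑ K ∈ T, intElem K (fun x => frob (cOp (c K) (evT (f K) x)) (evT (g K) x)) := by
  have key : ∀ K ∈ T, ∀ x ∈ interior (hull K), frob (cOp (ν x) (F x)) (G x) =
      frob (evT (cOpPoly (c K) (f K)) x) (evT (g K) x) := fun K hK x hx => by
    rw [hν K hK x hx, hF K hK x hx, hG K hK x hx, evT_cOpPoly]
  rw [aForm, hT.integral_eq_sum hΩ]
  · refine Finset.sum_congr rfl fun K hK => intElem_congr fun x hx => ?_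
    rw [key K hK x hx, evT_cOpPoly]
  · intro K hK
    refine IntegrableOn.congr_fun ?_ (fun x hx => (key K hK x hx).symm)
      isOpen_interior.measurableSet
    exact (integrableOn_hull (continuous_frob _ _) K).mono_set interior_subset

/-- An element of a triangulation is determined by a set with interior points which it contains. -/
theorem eq_of_hull_subset (hT : IsTriangulation Ω T) {K L M : Simp} (hK : K ∈ T) (hL : L ∈ T)
    (hM : (interior (hull M)).Nonempty) (hMK : hull M ⊆ hull K) (hML : hull M ⊆ hull L) :
    K = L := by
  by_contra hne
  obtain ⟨x, hx⟩ := hM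
  exact Set.disjoint_left.mp (hT.disjoint_interior hK hL hne) (interior_mono hMK hx)
    (interior_mono hML hx)

/-- The elements inside a simplex `K` contribute at most the integral over `K`. -/
theorem sum_intElem_le (hT : IsTriangulation Ω T) {S : Finset Simp} (hS : S ⊆ T) {K : Simp}
    (hsub : ∀ L ∈ S, hull L ⊆ hull K) {g : Plane → ℝ} (hg : Continuous g) (h0 : ∀ x, 0 ≤ g x) :
    ∑ L ∈ S, intElem L g ≤ intElem K g := by
  have h1 : ∑ L ∈ S, intElem L g = ∫ x in ⋃ L ∈ S, interior (hull L), g x := by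
    rw [integral_biUnion_finset]
    · exact Finset.sum_congr rfl fun L _ => intElem_eq_interior L g
    · exact fun L _ => isOpen_interior.measurableSet
    · exact fun K hK L hL hne => hT.disjoint_interior (hS hK) (hS hL) hne
    · exact fun L _ => (integrableOn_hull hg L).mono_set interior_subset
  rw [h1]
  refine setIntegral_mono_set (integrableOn_hull hg K) (Eventually.of_forall h0) ?_
  exact Filter.Eventually.of_forall
    (Set.iUnion₂_subset fun L hL => interior_subset.trans (hsub L hL))

end IsTriangulation

/-! ### Polynomials controlled by their values on an edge -/

theorem exists_le_mul_norm_sq {V : Type*} [NormedAddCommGroup V] [InnerProductSpace ℝ V]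
    [FiniteDimensional ℝ V] (A B : V →ₗ[ℝ] V →ₗ[ℝ] ℝ) (hB : ∀ x, B x x = ‖x‖ ^ 2) :
    ∃ C, 0 < C ∧ ∀ x, A x x ≤ C * B x x := by
  let A' : V →L[ℝ] V →L[ℝ] ℝ := LinearMap.toContinuousBilinearMap A
  refine ⟨‖A'‖ + 1, by positivity, fun x => ?_⟩
  have h1 : A x x ≤ ‖A'‖ * ‖x‖ * ‖x‖ := (le_abs_self _).trans (A'.le_opNorm₂ x x)
  rw [hB]
  nlinarith [sq_nonneg ‖x‖]

/-- On a finite dimensional space, a definite quadratic form dominates every quadratic form. -/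
theorem exists_le_mul_of_posDef {V : Type*} [AddCommGroup V] [Module ℝ V] [FiniteDimensional ℝ V]
    (A B : V →ₗ[ℝ] V →ₗ[ℝ] ℝ) (hsymm : ∀ x y, B x y = B y x) (hpos : ∀ x, 0 ≤ B x x)
    (hdef : ∀ x, B x x = 0 → x = 0) : ∃ C, 0 < C ∧ ∀ x, A x x ≤ C * B x x := by
  let core : InnerProductSpace.Core ℝ V :=
    { inner := fun x y => B x y
      conj_inner_symm := fun x y => hsymm y x
      re_inner_nonneg := hpos
      add_left := fun x y z => by simp
      smul_left := fun x y r => by simp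
      definite := hdef }
  exact @exists_le_mul_norm_sq V core.toNormedAddCommGroup (InnerProductSpace.ofCore core.toCore)
    ‹_› A B fun x => @real_inner_self_eq_norm_sq V
      core.toNormedAddCommGroup.toSeminormedAddCommGroup
      (InnerProductSpace.ofCore core.toCore) x

theorem integrableOn_refTri {g : Plane → ℝ} (hg : Continuous g) : IntegrableOn g refTri :=
  hg.continuousOn.integrableOn_compact isCompact_refTri

/-- The inner product of polynomials in `L²` of the reference triangle. -/
def refForm : Poly →ₗ[ℝ] Poly →ₗ[ℝ] ℝ :=
  LinearMap.mk₂ ℝ (fun p q => ∫ x in refTri, ev p x * ev q x)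
    (fun p p' q => by
      simp only [ev_add, add_mul]
      exact integral_add (integrableOn_refTri ((continuous_ev _).mul (continuous_ev _)))
        (integrableOn_refTri ((continuous_ev _).mul (continuous_ev _))))
    (fun c p q => by
      simp only [ev_smul, mul_assoc]
      exact integral_const_mul _ _)
    (fun p q q' => by
      simp only [ev_add, mul_add]
      exact integral_add (integrableOn_refTri ((continuous_ev _).mul (continuous_ev _)))
        (integrableOn_refTri ((continuous_ev _).mul (continuous_ev _))))
    (fun c p q => by
      simp only [ev_smul, mul_left_comm _ c]
      exact integral_const_mul _ _)

theorem refForm_apply (p q : Poly) : refForm p q = ∫ x in refTri, ev p x * ev q x := rfl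

theorem continuous_ev_edge (p : Poly) : Continuous fun s : ℝ => ev p !₂[s, 0] :=
  (continuous_ev p).comp ((PiLp.continuous_toLp 2 _).comp (by fun_prop))

theorem intervalIntegrable_edge (p q : Poly) :
    IntervalIntegrable (fun s : ℝ => ev p !₂[s, 0] * ev q !₂[s, 0]) volume 0 1 :=
  ((continuous_ev_edge p).mul (continuous_ev_edge q)).intervalIntegrable _ _

/-- The inner product of the traces in `L²` of the edge from `(0,0)` to `(1,0)`. -/
def edgeForm : Poly →ₗ[ℝ] Poly →ₗ[ℝ] ℝ :=
  LinearMap.mk₂ ℝ (fun p q => ∫ s in (0 : ℝ)..1, ev p !₂[s, 0] * ev q !₂[s, 0])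
    (fun p p' q => by
      simp only [ev_add, add_mul]
      exact intervalIntegral.integral_add (intervalIntegrable_edge _ _)
        (intervalIntegrable_edge _ _))
    (fun c p q => by
      simp only [ev_smul, mul_assoc]
      exact intervalIntegral.integral_const_mul _ _)
    (fun p q q' => by
      simp only [ev_add, mul_add]
      exact intervalIntegral.integral_add (intervalIntegrable_edge _ _)
        (intervalIntegrable_edge _ _))
    (fun c p q => by
      simp only [ev_smul, mul_left_comm _ c]
      exact intervalIntegral.integral_const_mul _ _)

theorem edgeForm_apply (p q : Poly) :
    edgeForm p q = ∫ s in (0 : ℝ)..1, ev p !₂[s, 0] * ev q !₂[s, 0] := rfl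

/-- A polynomial of degree at most `r` that is `L²`-orthogonal to the polynomials of lower degree
and vanishes on an edge is zero: it is the product of the height `y` over the edge and some `q`, and
orthogonality to `q` gives `∫ y q² = 0`. -/
theorem eq_zero_of_edgeForm_eq_zero {r : ℤ} {p : Poly} (hp : p ∈ polySpace r)
    (horth : ∀ w ∈ polySpace (r - 1), refForm p w = 0) (h0 : edgeForm p p = 0) : p = 0 := by
  have hvan : ∀ s ∈ Set.Icc (0 : ℝ) 1, ev p !₂[s, 0] = 0 := by
    by_contra! hcon
    obtain ⟨s, hs, hne⟩ := hcon
    have hc := (continuous_ev_edge p).mul (continuous_ev_edge p)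
    refine absurd h0 (ne_of_gt ?_)
    rw [edgeForm_apply]
    exact intervalIntegral.integral_pos zero_lt_one hc.continuousOn
      (fun x _ => mul_self_nonneg _) ⟨s, hs, mul_self_pos.mpr hne⟩
  obtain ⟨q, hq, rfl⟩ := exists_X_mul_of_vanish hp hvan
  have h1 := horth q hq
  rw [refForm_apply] at h1
  have hc : Continuous fun x => ev (MvPolynomial.X 1 * q) x * ev q x :=
    (continuous_ev _).mul (continuous_ev _)
  have hnn : 0 ≤ᵐ[volume.restrict refTri] fun x => ev (MvPolynomial.X 1 * q) x * ev q x := by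
    refine (ae_restrict_iff' isClosed_refTri.measurableSet).mpr (Eventually.of_forall ?_)
    intro x hx
    have := hx.2.1
    simp only [ev_mul, ev_X, Pi.zero_apply, mul_assoc]
    exact mul_nonneg this (mul_self_nonneg _)
  have h2 := (setIntegral_eq_zero_iff_of_nonneg_ae hnn (integrableOn_refTri hc)).mp h1
  let U : Set Plane := {x | x 0 ∈ Set.Ioo (0 : ℝ) (1 / 2)} ∩ {x | x 1 ∈ Set.Ioo (0 : ℝ) (1 / 2)}
  have hU : IsOpen U :=
    (isOpen_Ioo.preimage (by fun_prop : Continuous fun x : Plane => x 0)).inter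
      (isOpen_Ioo.preimage (by fun_prop : Continuous fun x : Plane => x 1))
  have hUR : U ⊆ refTri := fun x hx =>
    ⟨hx.1.1.le, hx.2.1.le, by have := hx.1.2; have := hx.2.2; linarith⟩
  have h3 := Measure.eqOn_open_of_ae_eq (ae_restrict_of_ae_restrict_of_subset hUR h2) hU
    hc.continuousOn continuousOn_const
  have hq0 : q = 0 := by
    refine eq_zero_of_ev_eq_zero (s := fun _ => Set.Ioo (0 : ℝ) (1 / 2))
      (fun _ => Set.Ioo_infinite (by norm_num)) fun x hx => ?_
    have h4 := h3 (⟨hx 0, hx 1⟩ : x ∈ U)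
    simp only [ev_mul, ev_X, Pi.zero_apply, mul_assoc] at h4
    have h5 := (hx 1).1.ne'
    simpa [h5] using h4
  rw [hq0, mul_zero]

/-- A polynomial of degree at most `r` that is orthogonal to the polynomials of lower degree on the
reference triangle is controlled by its trace on one edge. -/
theorem exists_refForm_le_edgeForm (r : ℤ) : ∃ C, 0 < C ∧ ∀ p ∈ polySpace r,
    (∀ w ∈ polySpace (r - 1), refForm p w = 0) → refForm p p ≤ C * edgeForm p p := by
  let V : Submodule ℝ Poly :=
    { carrier := {p | p ∈ polySpace r ∧ ∀ w ∈ polySpace (r - 1), refForm p w = 0}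
      add_mem' := fun {p q} hp hq => ⟨Submodule.add_mem _ hp.1 hq.1, fun w hw => by
        rw [map_add, LinearMap.add_apply, hp.2 w hw, hq.2 w hw, add_zero]⟩
      zero_mem' := ⟨Submodule.zero_mem _, fun w _ => by simp⟩
      smul_mem' := fun c p hp => ⟨Submodule.smul_mem _ _ hp.1, fun w hw => by
        rw [map_smul, LinearMap.smul_apply, hp.2 w hw, smul_zero]⟩ }
  have := finite_polySpace r
  have : FiniteDimensional ℝ V :=
    Submodule.finiteDimensional_of_le (S₂ := polySpace r) fun p hp => hp.1
  obtain ⟨C, hC, h⟩ := exists_le_mul_of_posDef (refForm.domRestrict₁₂ V V)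
    (edgeForm.domRestrict₁₂ V V)
    (fun p q => by
      simp only [LinearMap.domRestrict₁₂_apply, edgeForm_apply, mul_comm])
    (fun p => by
      simp only [LinearMap.domRestrict₁₂_apply, edgeForm_apply]
      exact intervalIntegral.integral_nonneg zero_le_one fun s _ => mul_self_nonneg _)
    (fun p hp => Subtype.ext (eq_zero_of_edgeForm_eq_zero p.2.1 p.2.2 hp))
  exact ⟨C, hC, fun p hp ho => h ⟨p, hp, ho⟩⟩

/-- The affine map of the reference triangle onto the triangle `a`, `b`, `c`, as a substitution. -/
def triSubst (a b c : Plane) (i : Fin 2) : Poly :=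
  MvPolynomial.C (a i) + (b i - a i) • MvPolynomial.X 0 + (c i - a i) • MvPolynomial.X 1

theorem triSubst_mem (a b c : Plane) (i : Fin 2) : triSubst a b c i ∈ polySpace 1 :=
  Submodule.add_mem _ (Submodule.add_mem _ (polySpace_mono zero_le_one (C_mem_polySpace _))
    (Submodule.smul_mem _ _ (X_mem_polySpace 0))) (Submodule.smul_mem _ _ (X_mem_polySpace 1))

theorem ev_bind₁_triSubst (a b c : Plane) (p : Poly) (x : Plane) :
    ev (MvPolynomial.bind₁ (triSubst a b c) p) x = ev p (triMap a b c x) := by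
  rw [ev_bind₁]
  congr 1
  ext i
  simp [triSubst, triMap_apply]
  ring

/-- The inverse of an affine map of the reference triangle onto a triangle is of the same form. -/
theorem exists_triMap_inverse {a b c : Plane} (h : cross (b - a) (c - a) ≠ 0) :
    ∃ a' b' c', ∀ x, triMap a' b' c' (triMap a b c x) = x := by
  set D := cross (b - a) (c - a) with hD
  let G : Plane → Plane := fun x => !₂[cross (x - a) (c - a) / D, cross (b - a) (x - a) / D]
  refine ⟨G 0, G !₂[1, 0], G !₂[0, 1], fun x => ?_⟩
  have hD' : D = (b 0 - a 0) * (c 1 - a 1) - (b 1 - a 1) * (c 0 - a 0) := by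
    simp [hD, cross]
  ext i
  rw [triMap_apply, triMap_apply, triMap_apply]
  fin_cases i
  · simp [G, cross]; field_simp; rw [hD']; ring
  · simp [G, cross]; field_simp; rw [hD']; ring

/-- The trace estimate on a triangle; `|cross (b - a) (c - a)| / ‖b - a‖` is the height over the
edge `{a, b}`. -/
theorem exists_intElem_le_intEdge (r : ℤ) : ∃ C, 0 < C ∧ ∀ {K : Simp} {a b c : Plane},
    IsLabeling K a b c → ∀ p ∈ polySpace r,
      (∀ w ∈ polySpace (r - 1), intElem K (fun x => ev p x * ev w x) = 0) →
      intElem K (fun x => ev p x * ev p x) ≤ C * (|cross (b - a) (c - a)| / ‖b - a‖) *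
        intEdge {a, b} (fun x => ev p x * ev p x) := by
  obtain ⟨C, hC, h⟩ := exists_refForm_le_edgeForm r
  refine ⟨C, hC, fun {K a b c} hL p hp ho => ?_⟩
  set p' := MvPolynomial.bind₁ (triSubst a b c) p with hp'
  have hD : 0 < |cross (b - a) (c - a)| := abs_pos.mpr hL.cross_ne
  have hl : 0 < ‖b - a‖ := norm_pos_iff.mpr (sub_ne_zero.mpr hL.ne.symm)
  obtain ⟨a', b', c', hinv⟩ := exists_triMap_inverse hL.cross_ne
  have h1 := h p' (bind₁_mem_polySpace hp (triSubst_mem a b c)) (fun w hw => by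
    have := ho _ (bind₁_mem_polySpace hw (triSubst_mem a' b' c'))
    rw [hL.eq, intElem_eq hL.cross_ne] at this
    simp only [ev_bind₁_triSubst, hinv] at this
    rw [refForm_apply]
    simp only [hp', ev_bind₁_triSubst]
    exact (mul_eq_zero.mp this).resolve_left hD.ne')
  have h2 : ∀ s : ℝ, triMap a b c !₂[s, 0] = a + s • (b - a) := fun s => by simp [triMap]
  rw [refForm_apply, edgeForm_apply] at h1
  simp only [hp', ev_bind₁_triSubst, h2] at h1
  rw [intEdge_eq hL.ne, hL.eq, intElem_eq hL.cross_ne]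
  calc _ ≤ |cross (b - a) (c - a)| * _ := mul_le_mul_of_nonneg_left h1 hD.le
    _ = _ := by field_simp

/-! ### Tensors controlled by their normal-normal components -/

theorem bil_smul (r : ℝ) (a : Plane) (A : Tensor) : bil (r • a) A (r • a) = r ^ 2 * bil a A a := by
  simp [bil, Fin.sum_univ_two]; ring

theorem bil_sub (a : Plane) (A B : Tensor) (b : Plane) :
    bil a (A - B) b = bil a A b - bil a B b := by
  simp [bil, Fin.sum_univ_two]; ring

theorem frob_self_nonneg (A : Tensor) : 0 ≤ frob A A :=
  Finset.sum_nonneg fun _ _ => Finset.sum_nonneg fun _ _ => mul_self_nonneg _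

theorem frob_comm (A B : Tensor) : frob A B = frob B A := by simp only [frob, mul_comm]

theorem frob_sub_left (A B D : Tensor) : frob (A - B) D = frob A D - frob B D := by
  simp [frob, Fin.sum_univ_two]; ring

theorem frob_sub_self_le (A B : Tensor) :
    frob (A - B) (A - B) ≤ 2 * frob A A + 2 * frob B B := by
  simp only [frob, Fin.sum_univ_two, Matrix.sub_apply]
  nlinarith [sq_nonneg (A 0 0 + B 0 0), sq_nonneg (A 0 1 + B 0 1), sq_nonneg (A 1 0 + B 1 0),
    sq_nonneg (A 1 1 + B 1 1)]

/-- A symmetric tensor in terms of its quadratic form on the rotated vectors `u`, `v`, `v - u`: the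
vectors `v` and `-u`, divided by `cross u v`, are dual to `rot u` and `rot v`. -/
theorem frob_self_le_of_bil {A : Tensor} (hA : A.IsSymm) (u v : Plane) {E : ℝ}
    (hu : ‖u‖ ^ 2 ≤ E) (hv : ‖v‖ ^ 2 ≤ E) :
    cross u v ^ 4 * frob A A ≤ 12 * E ^ 2 * (bil (rot u) A (rot u) ^ 2 +
      bil (rot v) A (rot v) ^ 2 + bil (rot (v - u)) A (rot (v - u)) ^ 2) := by
  set P := bil (rot u) A (rot u) with hP
  set Q := bil (rot v) A (rot v) with hQ
  set Z := bil (rot (v - u)) A (rot (v - u)) with hZ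
  set R := (P + Q - Z) / 2 with hR
  have hs : A 1 0 = A 0 1 := hA.apply 0 1
  have hE : 0 ≤ E := (sq_nonneg _).trans hu
  rw [plane_norm_sq] at hu hv
  have hPe : P = u 1 ^ 2 * A 0 0 - 2 * (u 0 * u 1) * A 0 1 + u 0 ^ 2 * A 1 1 := by
    simp [hP, bil, rot, Fin.sum_univ_two, hs]; ring
  have hQe : Q = v 1 ^ 2 * A 0 0 - 2 * (v 0 * v 1) * A 0 1 + v 0 ^ 2 * A 1 1 := by
    simp [hQ, bil, rot, Fin.sum_univ_two, hs]; ring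
  have hRe : R = u 1 * v 1 * A 0 0 - (u 0 * v 1 + u 1 * v 0) * A 0 1 + u 0 * v 0 * A 1 1 := by
    rw [hR, hPe, hQe, hZ]; simp [bil, rot, Fin.sum_univ_two, hs]; ring
  clear_value P Q Z R
  have key : ∀ p q r x y z : ℝ, (p * x - r * y + q * z) ^ 2 ≤
      3 * (p ^ 2 * x ^ 2 + r ^ 2 * y ^ 2 + q ^ 2 * z ^ 2) := fun p q r x y z => by
    nlinarith [sq_nonneg (p * x + r * y), sq_nonneg (p * x - q * z), sq_nonneg (r * y + q * z)]
  have e00 : cross u v ^ 2 * A 0 0 = P * v 0 ^ 2 - R * (2 * (u 0 * v 0)) + Q * u 0 ^ 2 := by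
    rw [hPe, hQe, hRe, cross]; ring
  have e01 : cross u v ^ 2 * A 0 1 =
      P * (v 0 * v 1) - R * (u 0 * v 1 + u 1 * v 0) + Q * (u 0 * u 1) := by
    rw [hPe, hQe, hRe, cross]; ring
  have e11 : cross u v ^ 2 * A 1 1 = P * v 1 ^ 2 - R * (2 * (u 1 * v 1)) + Q * u 1 ^ 2 := by
    rw [hPe, hQe, hRe, cross]; ring
  have h1 : cross u v ^ 4 * frob A A = (cross u v ^ 2 * A 0 0) ^ 2 +
      2 * (cross u v ^ 2 * A 0 1) ^ 2 + (cross u v ^ 2 * A 1 1) ^ 2 := by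
    simp only [frob, Fin.sum_univ_two, hs]; ring
  have k00 := key P Q R (v 0 ^ 2) (2 * (u 0 * v 0)) (u 0 ^ 2)
  have k01 := key P Q R (v 0 * v 1) (u 0 * v 1 + u 1 * v 0) (u 0 * u 1)
  have k11 := key P Q R (v 1 ^ 2) (2 * (u 1 * v 1)) (u 1 ^ 2)
  rw [← e00] at k00
  rw [← e01] at k01
  rw [← e11] at k11
  have hV : (v 0 ^ 2 + v 1 ^ 2) ^ 2 ≤ E ^ 2 := pow_le_pow_left₀ (by positivity) hv 2
  have hU : (u 0 ^ 2 + u 1 ^ 2) ^ 2 ≤ E ^ 2 := pow_le_pow_left₀ (by positivity) hu 2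
  have hUV : (2 * (u 0 * v 0)) ^ 2 + 2 * (u 0 * v 1 + u 1 * v 0) ^ 2 + (2 * (u 1 * v 1)) ^ 2 ≤
      4 * E ^ 2 := by
    have : (u 0 ^ 2 + u 1 ^ 2) * (v 0 ^ 2 + v 1 ^ 2) ≤ E * E :=
      mul_le_mul hu hv (by positivity) hE
    linarith [sq_nonneg (u 0 * v 1 - u 1 * v 0)]
  have h2 : cross u v ^ 4 * frob A A ≤
      3 * (P ^ 2 * E ^ 2 + R ^ 2 * (4 * E ^ 2) + Q ^ 2 * E ^ 2) := by
    have a1 := mul_le_mul_of_nonneg_left hV (sq_nonneg P)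
    have a2 := mul_le_mul_of_nonneg_left hU (sq_nonneg Q)
    have a3 := mul_le_mul_of_nonneg_left hUV (sq_nonneg R)
    rw [h1]
    linear_combination k00 + 2 * k01 + k11 + 3 * a1 + 3 * a2 + 3 * a3
  have h3 : 4 * R ^ 2 ≤ 3 * (P ^ 2 + Q ^ 2 + Z ^ 2) := by
    have h4 : 4 * R ^ 2 = (P + Q - Z) ^ 2 := by rw [hR]; ring
    linarith [sq_nonneg (P - Q), sq_nonneg (P + Z), sq_nonneg (Q + Z)]
  have h4 := mul_le_mul_of_nonneg_right h3 (sq_nonneg E)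
  linarith [mul_nonneg (sq_nonneg Z) (sq_nonneg E), mul_nonneg (sq_nonneg P) (sq_nonneg E),
    mul_nonneg (sq_nonneg Q) (sq_nonneg E)]

theorem IsLabeling.norm_sub_le_diam {K : Simp} {a b c : Plane} (h : IsLabeling K a b c) :
    ‖b - a‖ ≤ Metric.diam (hull K) := by
  rw [← dist_eq_norm, dist_comm]
  exact Metric.dist_le_diam_of_mem (isCompact_hull K).isBounded
    (subset_convexHull ℝ _ (by simp [h.eq])) (subset_convexHull ℝ _ (by simp [h.eq]))

theorem IsLabeling.meshSize_sq {K : Simp} {a b c : Plane} (h : IsLabeling K a b c) :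
    meshSize K ^ 2 = |cross (b - a) (c - a)| / 2 := by
  rw [h.eq]; exact HCDG.meshSize_sq h.cross_ne

theorem meshSize_pos {K : Simp} (hK : IsTriangle K) : 0 < meshSize K := by
  obtain ⟨a, b, c, h⟩ := exists_isLabeling hK
  have h1 := h.meshSize_sq
  have h2 : 0 < |cross (b - a) (c - a)| := abs_pos.mpr h.cross_ne
  refine lt_of_le_of_ne (Real.sqrt_nonneg _) fun h0 => ?_
  rw [← h0] at h1
  linarith

/-- The height over an edge is at most the diameter. -/
theorem IsLabeling.cross_div_norm_le {K : Simp} {a b c : Plane} (h : IsLabeling K a b c) :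
    |cross (b - a) (c - a)| / ‖b - a‖ ≤ Metric.diam (hull K) := by
  have hl : 0 < ‖b - a‖ := norm_pos_iff.mpr (sub_ne_zero.mpr h.ne.symm)
  have h1 := h.inner_outNormal
  have h2 := abs_real_inner_le_norm (outNormal K {a, b}) (c - a)
  rw [(isUnitNormal_outNormal h.triangle h.mem_edges).1, one_mul] at h2
  rw [div_le_iff₀ hl, ← neg_neg |_|, ← h1, ← mul_neg, mul_comm]
  exact mul_le_mul_of_nonneg_right ((neg_le_abs _).trans (h2.trans h.swap.norm_sub_le_diam)) hl.le

theorem bil_rot_sq_le {K : Simp} {a b c : Plane} (h : IsLabeling K a b c) (A : Tensor) {E : ℝ}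
    (hE : ‖b - a‖ ^ 2 ≤ E) :
    bil (rot (b - a)) A (rot (b - a)) ^ 2 ≤
      E ^ 2 * bil (outNormal K {a, b}) A (outNormal K {a, b}) ^ 2 := by
  obtain ⟨α, hn, hα⟩ := (isUnitNormal_outNormal h.triangle h.mem_edges).exists_eq_smul h.ne
  have h1 : bil (rot (b - a)) A (rot (b - a)) =
      ‖b - a‖ ^ 2 * bil (outNormal K {a, b}) A (outNormal K {a, b}) := by
    rw [hn, bil_smul]; linear_combination (-bil (rot (b - a)) A (rot (b - a))) * hα
  rw [h1, mul_pow]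
  exact mul_le_mul_of_nonneg_right (pow_le_pow_left₀ (by positivity) hE 2) (sq_nonneg _)

/-- On a shape-regular triangle, a symmetric tensor is bounded by its normal-normal components. -/
theorem frob_self_le_sum_bil {K : Simp} (hK : IsTriangle K) {κ : ℝ}
    (hκ : Metric.diam (hull K) ≤ κ * meshSize K) {A : Tensor} (hA : A.IsSymm) :
    frob A A ≤ κ ^ 8 * ∑ e ∈ edges K, bil (outNormal K e) A (outNormal K e) ^ 2 := by
  obtain ⟨a, b, c, h⟩ := exists_isLabeling hK
  set H := meshSize K with hH
  have hpos : 0 < H := meshSize_pos hK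
  have hsq : ∀ {a b c : Plane}, IsLabeling K a b c → ‖b - a‖ ^ 2 ≤ (κ * H) ^ 2 := fun h =>
    pow_le_pow_left₀ (norm_nonneg _) (h.norm_sub_le_diam.trans hκ) 2
  have h1 := frob_self_le_of_bil hA (b - a) (c - a) (hsq h) (hsq h.swap)
  have e1 : c - a - (b - a) = c - b := by abel
  rw [e1] at h1
  have hD : cross (b - a) (c - a) ^ 4 = 16 * H ^ 8 := by
    have : cross (b - a) (c - a) ^ 4 = |cross (b - a) (c - a)| ^ 4 := by
      rw [← abs_pow]; exact (abs_of_nonneg (by positivity)).symm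
    rw [this, show |cross (b - a) (c - a)| = 2 * H ^ 2 by rw [hH, h.meshSize_sq]; ring]; ring
  have b1 := bil_rot_sq_le h A (hsq h)
  have b2 := bil_rot_sq_le h.swap A (hsq h.swap)
  have b3 := bil_rot_sq_le h.rotate A (hsq h.rotate)
  rw [h.sum_edges (fun e => bil (outNormal K e) A (outNormal K e) ^ 2)]
  set S := bil (outNormal K {a, b}) A (outNormal K {a, b}) ^ 2 +
    bil (outNormal K {a, c}) A (outNormal K {a, c}) ^ 2 +
    bil (outNormal K {b, c}) A (outNormal K {b, c}) ^ 2 with hS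
  have hS0 : 0 ≤ S := by positivity
  have h2 : 16 * H ^ 8 * frob A A ≤ 12 * ((κ * H) ^ 2) ^ 2 * (((κ * H) ^ 2) ^ 2 * S) := by
    rw [hD] at h1
    refine h1.trans (mul_le_mul_of_nonneg_left ?_ (by positivity))
    rw [hS]; linarith
  have h3 : 16 * H ^ 8 * frob A A ≤ 16 * H ^ 8 * (κ ^ 8 * S) := by
    refine h2.trans ?_
    have : 0 ≤ κ ^ 8 * S * H ^ 8 := mul_nonneg (mul_nonneg (by positivity) hS0) (by positivity)
    nlinarith
  exact le_of_mul_le_mul_left h3 (by positivity)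

/-! ### Stability of the correction on one element -/

theorem intElem_sum {K : Simp} {ι : Type*} (s : Finset ι) {f : ι → Plane → ℝ}
    (hf : ∀ i, Continuous (f i)) :
    intElem K (fun x => ∑ i ∈ s, f i x) = ∑ i ∈ s, intElem K (f i) :=
  integral_finsetSum _ fun i _ => integrableOn_hull (hf i) K

theorem intBdry_nonneg {K : Simp} {f : Simp → Plane → ℝ} (h : ∀ e x, 0 ≤ f e x) :
    0 ≤ intBdry K f := Finset.sum_nonneg fun e _ => integral_nonneg (h e)

/-- Orthogonality to the tensors of lower degree is inherited by the components. -/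
theorem orthogonal_bilPoly {K : Simp} {r : ℤ} {δ : PolyTensor}
    (ho : ∀ τ ∈ symPolySpace r, intElem K (fun x => frob (evT δ x) (evT τ x)) = 0) (n : Plane)
    {w : Poly} (hw : w ∈ polySpace r) :
    intElem K (fun x => ev (bilPoly n δ n) x * ev w x) = 0 := by
  -- test with `w n nᵀ`
  let τ : PolyTensor := Matrix.of fun i j => (n i * n j) • w
  have hτ : τ ∈ symPolySpace r := ⟨Matrix.IsSymm.ext fun i j => by simp [τ, mul_comm],
    fun i j => Submodule.smul_mem _ _ hw⟩
  rw [← ho τ hτ]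
  congr 1
  funext x
  simp only [ev_bilPoly, bil, frob, Fin.sum_univ_two, evT_apply, τ, Matrix.of_apply, ev_smul]
  ring

theorem exists_frob_le_intBdry (r : ℤ) (κ : ℝ) : ∃ C, 0 < C ∧ ∀ {K : Simp}, IsTriangle K →
    Metric.diam (hull K) ≤ κ * meshSize K → ∀ δ ∈ symPolySpace r,
      (∀ τ ∈ symPolySpace (r - 1), intElem K (fun x => frob (evT δ x) (evT τ x)) = 0) →
      intElem K (fun x => frob (evT δ x) (evT δ x)) ≤ C * meshSize K *
        intBdry K (fun e x => bil (outNormal K e) (evT δ x) (outNormal K e) *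
          bil (outNormal K e) (evT δ x) (outNormal K e)) := by
  obtain ⟨C, hC, h⟩ := exists_intElem_le_intEdge r
  refine ⟨|κ| ^ 8 * (C * |κ|) + 1, by positivity, fun {K} hK hκ δ hδ ho => ?_⟩
  set H := meshSize K with hH
  have hpos : 0 < H := meshSize_pos hK
  have hd : Metric.diam (hull K) ≤ |κ| * H :=
    hκ.trans (mul_le_mul_of_nonneg_right (le_abs_self κ) hpos.le)
  let g : Simp → Plane → ℝ := fun e x => bil (outNormal K e) (evT δ x) (outNormal K e)
  have hg : ∀ e, Continuous (g e) := fun e => continuous_bil δ _ _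
  have hsymm : ∀ x, (evT δ x).IsSymm := fun x => hδ.1.map _
  have h1 : intElem K (fun x => frob (evT δ x) (evT δ x)) ≤
      |κ| ^ 8 * ∑ e ∈ edges K, intElem K (fun x => g e x * g e x) := by
    rw [← intElem_sum (f := fun e x => g e x * g e x) _ (fun e => (hg e).mul (hg e)),
      ← intElem_const_mul]
    refine intElem_mono (continuous_frob _ _)
      ((continuous_finsetSum _ fun e _ => (hg e).mul (hg e)).const_mul _) fun x => ?_
    have := frob_self_le_sum_bil hK hd (hsymm x)
    simpa only [← pow_two] using this
  have h2 : ∀ e ∈ edges K, intElem K (fun x => g e x * g e x) ≤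
      C * (|κ| * H) * intEdge e (fun x => g e x * g e x) := by
    intro e he
    obtain ⟨a, b, c, hL, rfl⟩ := exists_isLabeling_of_mem_edges hK he
    have := h hL _ (bilPoly_mem hδ (outNormal K {a, b}) (outNormal K {a, b}))
      (fun w hw => orthogonal_bilPoly ho _ hw)
    simp only [ev_bilPoly] at this
    refine this.trans (mul_le_mul_of_nonneg_right ?_ (integral_nonneg fun x => mul_self_nonneg _))
    exact mul_le_mul_of_nonneg_left (hL.cross_div_norm_le.trans hd) hC.le
  have h3 := Finset.sum_le_sum h2
  rw [← Finset.mul_sum] at h3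
  have h4 : 0 ≤ intBdry K (fun e x => g e x * g e x) :=
    intBdry_nonneg fun e x => mul_self_nonneg _
  calc _ ≤ |κ| ^ 8 * (C * (|κ| * H) * intBdry K (fun e x => g e x * g e x)) :=
        h1.trans (mul_le_mul_of_nonneg_left h3 (by positivity))
    _ ≤ _ := by
        have := mul_nonneg hpos.le h4
        change _ ≤ (|κ| ^ 8 * (C * |κ|) + 1) * H * intBdry K (fun e x => g e x * g e x)
        linarith

/-- If the normal-normal trace of `δ` on the boundary is the Riesz representation of the functional
`ξ ∫ G : ·`, then `δ` is bounded by `h ξ G`. -/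
theorem exists_stability (r : ℤ) (κ : ℝ) : ∃ C, 0 < C ∧ ∀ {K : Simp}, IsTriangle K →
    Metric.diam (hull K) ≤ κ * meshSize K → ∀ δ ∈ symPolySpace r,
      (∀ τ ∈ symPolySpace (r - 1), intElem K (fun x => frob (evT δ x) (evT τ x)) = 0) →
      ∀ (ξ : ℝ) (G : PolyTensor), 0 ≤ ξ →
      intBdry K (fun e x => bil (outNormal K e) (evT δ x) (outNormal K e) *
          bil (outNormal K e) (evT δ x) (outNormal K e)) =
        ξ * intElem K (fun x => frob (evT G x) (evT δ x)) →
      intElem K (fun x => frob (evT δ x) (evT δ x)) ≤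
        C * (meshSize K * ξ) ^ 2 * intElem K (fun x => frob (evT G x) (evT G x)) := by
  obtain ⟨C, hC, h⟩ := exists_frob_le_intBdry r κ
  refine ⟨C ^ 2, by positivity, fun {K} hK hκ δ hδ ho ξ G hξ hG => ?_⟩
  have h1 := h hK hκ δ hδ ho
  rw [hG] at h1
  set A := C * meshSize K * ξ with hA
  -- Young's inequality, with a weight that lets the first term be absorbed
  have h2 : A * intElem K (fun x => frob (evT G x) (evT δ x)) ≤
      1 / 2 * intElem K (fun x => frob (evT δ x) (evT δ x)) +
        A ^ 2 / 2 * intElem K (fun x => frob (evT G x) (evT G x)) := by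
    rw [← intElem_const_mul, ← intElem_const_mul, ← intElem_const_mul,
      ← intElem_add ((continuous_frob _ _).const_mul _) ((continuous_frob _ _).const_mul _)]
    refine intElem_mono ((continuous_frob _ _).const_mul _)
      (((continuous_frob _ _).const_mul _).add ((continuous_frob _ _).const_mul _)) fun x => ?_
    have key : ∀ s t : ℝ, A * (s * t) ≤ 1 / 2 * (t * t) + A ^ 2 / 2 * (s * s) := fun s t => by
      nlinarith [sq_nonneg (A * s - t)]
    simp only [frob, Fin.sum_univ_two]
    have := key (evT G x 0 0) (evT δ x 0 0)
    have := key (evT G x 0 1) (evT δ x 0 1)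
    have := key (evT G x 1 0) (evT δ x 1 0)
    have := key (evT G x 1 1) (evT δ x 1 1)
    linarith
  have h3 : C ^ 2 * (meshSize K * ξ) ^ 2 = A ^ 2 := by rw [hA]; ring
  rw [h3]
  linarith

/-! ### The equation satisfied by the correction of the bending moment -/

theorem intElem_sub {K : Simp} {f g : Plane → ℝ} (hf : Continuous f) (hg : Continuous g) :
    intElem K (fun x => f x - g x) = intElem K f - intElem K g :=
  integral_sub (integrableOn_hull hf K) (integrableOn_hull hg K)

theorem intEdge_sub {K e : Simp} (hK : IsTriangle K) (he : e ∈ edges K) {f g : Plane → ℝ}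
    (hf : Continuous f) (hg : Continuous g) :
    intEdge e (fun x => f x - g x) = intEdge e f - intEdge e g :=
  integral_sub (integrableOn_edge hK he hf) (integrableOn_edge hK he hg)

theorem intBdry_sub {K : Simp} (hK : IsTriangle K) {f g : Simp → Plane → ℝ}
    (hf : ∀ e, Continuous (f e)) (hg : ∀ e, Continuous (g e)) :
    intBdry K (fun e x => f e x - g e x) = intBdry K f - intBdry K g := by
  rw [intBdry, intBdry, intBdry, ← Finset.sum_sub_distrib]
  exact Finset.sum_congr rfl fun e he => intEdge_sub hK he (hf e) (hg e)

theorem frob_zero_right (A : Tensor) : frob A 0 = 0 := by simp [frob]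

theorem bil_zero (a b : Plane) : bil a 0 b = 0 := by simp [bil]

theorem divT_zero (x : Plane) : divT 0 x = 0 := by
  ext i; simp [divT]

theorem mem_meshEdges {T : Finset Simp} {K e : Simp} (hK : K ∈ T) (he : e ∈ edges K) :
    e ∈ meshEdges T := by
  classical
  exact Finset.mem_biUnion.mpr ⟨K, hK, he⟩

section LocalEquation

variable {Ω : Set Plane} {T : Finset Simp} {k : ℕ} {nE : Simp → Plane} {ν f : Plane → ℝ}
  {C₀ γ : ℝ} {σ σh : Simp → PolyTensor} {u lam : Simp → Poly} {c : Simp → ℝ}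

/-- The moment equation, tested with a tensor supported on a single element. -/
theorem IsSolution.eq_moment_local (hT : IsTriangulation Ω T) (hΩ : IsOpen Ω)
    (hν : ∀ K ∈ T, ∀ x ∈ interior (hull K), ν x = c K)
    (hsol : IsSolution Ω T k nE ν f C₀ γ σ u lam) {K : Simp} (hK : K ∈ T) {τ : PolyTensor}
    (hτ : τ ∈ symPolySpace ((k : ℤ) - 1)) :
    intElem K (fun x => frob (evT (cOpPoly (c K) (σ K)) x) (evT τ x)) +
      (- intElem K (fun x => inner ℝ (divT τ x) (grad (u K) x)) +
      intBdry K (fun e x => bil (rot (outNormal K e)) (evT τ x) (outNormal K e) *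
        inner ℝ (rot (outNormal K e)) (grad (u K) x))) =
    - intBdry K (fun e x => bil (nE e) (evT τ x) (outNormal K e) * ev (lam e) x) := by
  classical
  let τ' : Simp → PolyTensor := Function.update 0 K τ
  have hK' : τ' K = τ := Function.update_self ..
  have hL : ∀ L, L ≠ K → τ' L = 0 := fun L h => Function.update_of_ne h ..
  have hmem : τ' ∈ sigmaSpace T k := by
    intro L _
    by_cases h : L = K
    · subst h; rwa [hK']
    · rw [hL L h]
      exact ⟨Matrix.isSymm_zero, fun i j => Submodule.zero_mem _⟩
  have h := hsol.eq_moment τ' hmem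
  rw [hT.aForm_eq_sum hΩ hν (fun L hLT x hx => hT.tensorField_eq σ hLT hx)
    (fun L hLT x hx => hT.tensorField_eq τ' hLT hx), bForm] at h
  rw [Finset.sum_eq_single_of_mem K hK, Finset.sum_eq_single_of_mem K hK,
    Finset.sum_eq_single_of_mem K hK, Finset.sum_eq_single_of_mem K hK, hK'] at h
  · simpa only [evT_cOpPoly] using h
  all_goals
    intro L _ hne
    rw [hL L hne]
    simp [intElem, intBdry, intEdge, frob_zero_right, bil_zero, divT_zero]

theorem IsPostprocessed.orthogonal (hpost : IsPostprocessed T k nE C₀ γ σ u lam σh) {K : Simp}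
    (hK : K ∈ T) {τ : PolyTensor} (hτ : τ ∈ symPolySpace ((k : ℤ) - 2)) :
    intElem K (fun x => frob (evT (σh K - σ K) x) (evT τ x)) = 0 := by
  simp only [evT_sub, frob_sub_left]
  rw [intElem_sub (continuous_frob _ _) (continuous_frob _ _), hpost.moments K hK τ hτ, sub_self]

/-- The normal-normal trace of the correction `σh - σ` represents the functional `ξ ∫ 𝒞σ : τ` on the
tensors `τ` that are orthogonal to those of lower degree. -/
theorem intBdry_correction (hT : IsTriangulation Ω T) (hΩ : IsOpen Ω)
    (hν : ∀ K ∈ T, ∀ x ∈ interior (hull K), ν x = c K)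
    (hnE : ∀ e ∈ meshEdges T, IsUnitNormal e (nE e))
    (hsol : IsSolution Ω T k nE ν f C₀ γ σ u lam)
    (hpost : IsPostprocessed T k nE C₀ γ σ u lam σh) {K : Simp} (hK : K ∈ T) {τ : PolyTensor}
    (hτ : τ ∈ symPolySpace ((k : ℤ) - 1))
    (ho : ∀ q ∈ symPolySpace ((k : ℤ) - 2), intElem K (fun x => frob (evT τ x) (evT q x)) = 0) :
    intBdry K (fun e x => bil (outNormal K e) (evT (σh K - σ K) x) (outNormal K e) *
      bil (outNormal K e) (evT τ x) (outNormal K e)) =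
    stab C₀ γ K * intElem K (fun x => frob (evT (cOpPoly (c K) (σ K)) x) (evT τ x)) := by
  have hKt := hT.triangle K hK
  have h1 := hsol.eq_moment_local hT hΩ hν hK hτ
  have hhess := ho _ (hessPoly_mem (hsol.mem_v.1 K hK))
  simp only [frob_comm (evT τ _)] at hhess
  rw [green_formula hKt, hhess] at h1
  have h2 : intElem K (fun x => frob (evT (cOpPoly (c K) (σ K)) x) (evT τ x)) =
      intBdry K (fun e x => bil (outNormal K e) (evT τ x) (outNormal K e) *
        inner ℝ (outNormal K e) (grad (u K) x) -
        bil (nE e) (evT τ x) (outNormal K e) * ev (lam e) x) := by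
    rw [intBdry_sub hKt (fun e => (continuous_bil τ _ _).fun_mul (continuous_inner_grad (u K) _))
      (fun e => (continuous_bil τ _ _).fun_mul (continuous_ev _))]
    linarith
  rw [h2, ← intBdry_const_mul]
  refine Finset.sum_congr rfl fun e he => ?_
  obtain ⟨hn, hs⟩ := (hnE e (mem_meshEdges hK he)).eq_smul hKt he (isUnitNormal_outNormal hKt he)
  set s : ℝ := inner ℝ (nE e) (outNormal K e) with hsdef
  have hnn : ∀ A : Tensor, bil (outNormal K e) A (outNormal K e) = bil (nE e) A (nE e) := by
    intro A; rw [hn, bil_smul, hs, one_mul]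
  have hen : ∀ A : Tensor, bil (nE e) A (outNormal K e) = s * bil (nE e) A (nE e) := by
    intro A; rw [hn]; simp [bil, Fin.sum_univ_two]; ring
  have hin : ∀ w : Plane, (inner ℝ (outNormal K e) w : ℝ) = s * inner ℝ (nE e) w := by
    intro w; rw [hn, inner_smul_left]; rfl
  -- the moments of the numerical trace, tested with the normal-normal trace of `τ`
  have h3 := hpost.normal K hK e he _ (bilPoly_mem hτ (nE e) (nE e))
  simp only [ev_bilPoly] at h3
  have hcσ := continuous_bil (σ K) (nE e) (nE e)
  have hcτ := continuous_bil τ (nE e) (nE e)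
  have hcσh := continuous_bil (σh K) (nE e) (nE e)
  have hcfl : Continuous fun x => flux C₀ γ nE σ u lam K e x := by
    unfold flux
    exact hcσ.add (((continuous_inner_grad (u K) _).sub (continuous_ev _)).const_mul _
      |>.mul_const _)
  simp only [hnn, hen, hin, evT_sub, bil_sub, sub_mul]
  rw [intEdge_sub hKt he (hcσh.fun_mul hcτ) (hcσ.fun_mul hcτ), h3,
    ← intEdge_sub hKt he (hcfl.fun_mul hcτ) (hcσ.fun_mul hcτ)]
  congr 1
  funext x
  simp only [flux, ← hsdef]
  ring

end LocalEquation

/-! ### The elasticity operator and the stabilization parameter -/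

theorem frob_cOp_self_bounds {c : ℝ} (h0 : 0 < c) (h1 : c < 1 / 2) (A : Tensor) :
    frob A A ≤ 2 * frob (cOp c A) A ∧ frob (cOp c A) A ≤ 2 * frob A A ∧
      frob (cOp c A) (cOp c A) ≤ 4 * frob A A := by
  set p := 1 / (1 - c) with hp
  set q := c / (1 - c ^ 2) with hq
  have hc1 : 0 < 1 - c := by linarith
  have hc2 : 0 < 1 + c := by linarith
  have hc3 : 0 < 1 - c ^ 2 := by nlinarith
  have hp2 : p ≤ 2 := by rw [hp, div_le_iff₀ hc1]; linarith
  have hq0 : 0 ≤ q := by positivity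
  have hpq : 1 / 2 ≤ p - 2 * q := by
    have : p - 2 * q = 1 / (1 + c) := by
      have : 1 - c ^ 2 = (1 - c) * (1 + c) := by ring
      rw [hp, hq, this]; field_simp; ring
    rw [this, div_le_div_iff₀ two_pos hc2]; linarith
  have hp0 : 0 ≤ p := by linarith
  have htr : A.trace ^ 2 ≤ 2 * frob A A := by
    simp only [Matrix.trace, Matrix.diag, frob, Fin.sum_univ_two]
    nlinarith [sq_nonneg (A 0 0 - A 1 1), sq_nonneg (A 0 1), sq_nonneg (A 1 0)]
  have hA := frob_self_nonneg A
  have e1 : frob (cOp c A) A = p * frob A A - q * A.trace ^ 2 := by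
    simp [cOp, frob, Fin.sum_univ_two, Matrix.trace, ← hp, ← hq]; ring
  have e2 : frob (cOp c A) (cOp c A) = p ^ 2 * frob A A - 2 * q * (p - q) * A.trace ^ 2 := by
    simp [cOp, frob, Fin.sum_univ_two, Matrix.trace, ← hp, ← hq]; ring
  clear_value p q
  refine ⟨?_, ?_, ?_⟩
  · rw [e1]
    have := mul_le_mul_of_nonneg_left htr hq0
    have := mul_le_mul_of_nonneg_right hpq hA
    linarith
  · rw [e1]
    have := mul_nonneg hq0 (sq_nonneg A.trace)
    have := mul_le_mul_of_nonneg_right hp2 hA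
    linarith
  · rw [e2]
    have h3 : 0 ≤ 2 * q * (p - q) * A.trace ^ 2 :=
      mul_nonneg (mul_nonneg (by linarith) (by linarith)) (sq_nonneg _)
    have h4 : p ^ 2 ≤ 4 := by nlinarith
    have := mul_le_mul_of_nonneg_right h4 hA
    linarith

theorem meshSize_mono {K L : Simp} (h : hull K ⊆ hull L) : meshSize K ≤ meshSize L :=
  Real.sqrt_le_sqrt (measureReal_mono h (isCompact_hull L).measure_lt_top.ne)

theorem stab_nonneg {C₀ : ℝ} (hC₀ : 0 ≤ C₀) (γ : ℝ) (K : Simp) : 0 ≤ stab C₀ γ K :=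
  mul_nonneg hC₀ (Real.rpow_nonneg (Real.sqrt_nonneg _) _)

theorem meshSize_mul_stab_mono {C₀ γ : ℝ} (hC₀ : 0 ≤ C₀) (hγ : -1 < γ) {K L : Simp}
    (hK : IsTriangle K) (hL : IsTriangle L) (h : hull K ⊆ hull L) :
    meshSize K * stab C₀ γ K ≤ meshSize L * stab C₀ γ L := by
  have e : ∀ {M : Simp}, IsTriangle M → meshSize M * stab C₀ γ M = C₀ * meshSize M ^ (γ + 1) := by
    intro M hM
    rw [stab, Real.rpow_add_one (meshSize_pos hM).ne']; ring
  rw [e hK, e hL]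
  exact mul_le_mul_of_nonneg_left
    (Real.rpow_le_rpow (meshSize_pos hK).le (meshSize_mono h) (by linarith)) hC₀

theorem meshSize_mul_stab_le_stabConst {Ω : Set Plane} {C₀ γ : ℝ} (hC₀ : 0 ≤ C₀) (hγ : -1 < γ)
    {T₀ T : Finset Simp} (hT₀ : IsTriangulation Ω T₀) (hT : IsTriangulation Ω T)
    (href : IsRefinement T₀ T) {K : Simp} (hK : K ∈ T) :
    meshSize K * stab C₀ γ K ≤ stabConst C₀ γ T₀ := by
  obtain ⟨L, hL, hKL⟩ := href K hK
  refine (meshSize_mul_stab_mono hC₀ hγ (hT.triangle K hK) (hT₀.triangle L hL) hKL).trans ?_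
  exact le_ciSup (f := fun K : {K // K ∈ T₀} => meshSize K * stab C₀ γ K)
    (Set.finite_range _).bddAbove ⟨L, hL⟩

theorem IsPoissonRatio.exists_const {T₀ T : Finset Simp} {ν : Plane → ℝ}
    (hν : IsPoissonRatio T₀ ν) (href : IsRefinement T₀ T) :
    ∃ c : Simp → ℝ, ∀ K ∈ T, 0 < c K ∧ c K < 1 / 2 ∧ ∀ x ∈ interior (hull K), ν x = c K := by
  have h : ∀ K, ∃ c : ℝ, K ∈ T → 0 < c ∧ c < 1 / 2 ∧ ∀ x ∈ interior (hull K), ν x = c := by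
    intro K
    by_cases hK : K ∈ T
    · obtain ⟨L, hL, hKL⟩ := href K hK
      obtain ⟨c, h0, h1, h2⟩ := hν L hL
      exact ⟨c, fun _ => ⟨h0, h1, fun x hx => h2 x (interior_mono hKL hx)⟩⟩
    · exact ⟨0, fun h => absurd h hK⟩
  choose c hc using h
  exact ⟨c, hc⟩

/-- The energy norm of a piecewise polynomial tensor is equivalent to the `L²` norm. -/
theorem normC_sq_bounds {Ω : Set Plane} {T : Finset Simp} (hT : IsTriangulation Ω T)
    (hΩ : IsOpen Ω) {ν : Plane → ℝ} {c : Simp → ℝ}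
    (hc : ∀ K ∈ T, 0 < c K ∧ c K < 1 / 2 ∧ ∀ x ∈ interior (hull K), ν x = c K)
    {F : Plane → Tensor} {g : Simp → PolyTensor}
    (hF : ∀ K ∈ T, ∀ x ∈ interior (hull K), F x = evT (g K) x) :
    ∑ K ∈ T, intElem K (fun x => frob (evT (g K) x) (evT (g K) x)) ≤ 2 * normC Ω ν F ^ 2 ∧
    normC Ω ν F ^ 2 ≤ 2 * ∑ K ∈ T, intElem K (fun x => frob (evT (g K) x) (evT (g K) x)) := by
  have ha := hT.aForm_eq_sum hΩ (fun K hK => (hc K hK).2.2) hF hF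
  have hcont : ∀ K, Continuous fun x => frob (cOp (c K) (evT (g K) x)) (evT (g K) x) := fun K => by
    simpa only [← evT_cOpPoly] using continuous_frob (cOpPoly (c K) (g K)) (g K)
  have h1 : ∑ K ∈ T, intElem K (fun x => frob (evT (g K) x) (evT (g K) x)) ≤
      2 * aForm Ω ν F F := by
    rw [ha, Finset.mul_sum]
    refine Finset.sum_le_sum fun K hK => ?_
    rw [← intElem_const_mul]
    exact intElem_mono (continuous_frob _ _) ((hcont K).const_mul _) fun x =>
      (frob_cOp_self_bounds (hc K hK).1 (hc K hK).2.1 _).1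
  have h2 : aForm Ω ν F F ≤
      2 * ∑ K ∈ T, intElem K (fun x => frob (evT (g K) x) (evT (g K) x)) := by
    rw [ha, Finset.mul_sum]
    refine Finset.sum_le_sum fun K hK => ?_
    rw [← intElem_const_mul]
    exact intElem_mono (hcont K) ((continuous_frob _ _).const_mul _) fun x =>
      (frob_cOp_self_bounds (hc K hK).1 (hc K hK).2.1 _).2.1
  have h0 : 0 ≤ ∑ K ∈ T, intElem K (fun x => frob (evT (g K) x) (evT (g K) x)) :=
    Finset.sum_nonneg fun K _ => intElem_nonneg fun x => frob_self_nonneg _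
  rw [normC, Real.sq_sqrt (by linarith)]
  exact ⟨h1, h2⟩

/-! ### Comparison of the two triangulations -/

/-- The projection has the right degree even if its argument is not square integrable: it is `0`
then. -/
theorem l2Proj_mem (K : Simp) (r : ℤ) (g : Plane → ℝ) : l2Proj K r g ∈ polySpace r := by
  unfold l2Proj
  split_ifs with h
  · exact h.choose_spec.1
  · exact Submodule.zero_mem _

theorem l2ProjT_cOp_mem (K : Simp) (r : ℤ) (ν : Plane → ℝ) {τ : PolyTensor} (hτ : τ.IsSymm) :
    l2ProjT K r (fun y => cOp (ν y) (evT τ y)) ∈ symPolySpace r := by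
  refine ⟨Matrix.IsSymm.ext fun i j => ?_, fun i j => l2Proj_mem _ _ _⟩
  have hs : ∀ y, (cOp (ν y) (evT τ y)).IsSymm := fun y =>
    ((hτ.map _).smul _).sub (Matrix.isSymm_one.smul _)
  simp only [l2ProjT, Matrix.of_apply]
  congr 1
  funext y
  exact (hs y).apply i j

/-- The integral over `K` of the squared Frobenius norm of a polynomial tensor. -/
def normSq (K : Simp) (τ : PolyTensor) : ℝ := intElem K (fun x => frob (evT τ x) (evT τ x))

theorem normSq_nonneg (K : Simp) (τ : PolyTensor) : 0 ≤ normSq K τ :=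
  intElem_nonneg fun _ => frob_self_nonneg _

theorem normSq_sub_le (K : Simp) (σ τ : PolyTensor) :
    normSq K (σ - τ) ≤ 2 * normSq K σ + 2 * normSq K τ := by
  simp only [normSq, evT_sub]
  rw [← intElem_const_mul, ← intElem_const_mul,
    ← intElem_add ((continuous_frob _ _).const_mul _) ((continuous_frob _ _).const_mul _)]
  refine intElem_mono ?_
    (((continuous_frob _ _).const_mul _).add ((continuous_frob _ _).const_mul _))
    fun x => frob_sub_self_le _ _
  simpa only [← evT_sub] using continuous_frob (σ - τ) (σ - τ)

theorem normSq_add_le (K : Simp) (σ τ : PolyTensor) :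
    normSq K (σ + τ) ≤ 2 * normSq K σ + 2 * normSq K τ := by
  have h := normSq_sub_le K σ (-τ)
  have h1 : normSq K (-τ) = normSq K τ := by
    unfold normSq
    congr 1
    funext x
    simp [frob, evT_apply]
  rwa [sub_neg_eq_add, h1] at h

theorem normSq_cOpPoly_le (K : Simp) {c : ℝ} (h0 : 0 < c) (h1 : c < 1 / 2) (τ : PolyTensor) :
    normSq K (cOpPoly c τ) ≤ 4 * normSq K τ := by
  rw [normSq, normSq, ← intElem_const_mul]
  refine intElem_mono (continuous_frob _ _) ((continuous_frob _ _).const_mul _) fun x => ?_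
  rw [evT_cOpPoly]
  exact (frob_cOp_self_bounds h0 h1 _).2.2

/-- The correction on an element is bounded by the distance of `𝒞σ` from the tensors of degree at
most `k - 2`. -/
theorem exists_normSq_correction_le (k : ℕ) (κ : ℝ) : ∃ C, 0 < C ∧
    ∀ {Ω : Set Plane} {T : Finset Simp} {nE : Simp → Plane} {ν f : Plane → ℝ} {C₀ γ : ℝ}
      {σ σh : Simp → PolyTensor} {u lam : Simp → Poly} {c : Simp → ℝ},
    IsTriangulation Ω T → IsOpen Ω → IsShapeRegular κ T → 0 ≤ C₀ →
    (∀ K ∈ T, ∀ x ∈ interior (hull K), ν x = c K) →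
    (∀ e ∈ meshEdges T, IsUnitNormal e (nE e)) →
    IsSolution Ω T k nE ν f C₀ γ σ u lam → IsPostprocessed T k nE C₀ γ σ u lam σh →
    ∀ K ∈ T, ∀ q ∈ symPolySpace ((k : ℤ) - 2),
      normSq K (σh K - σ K) ≤
        C * (meshSize K * stab C₀ γ K) ^ 2 * normSq K (cOpPoly (c K) (σ K) - q) := by
  obtain ⟨C, hC, h⟩ := exists_stability ((k : ℤ) - 1) κ
  refine ⟨C, hC, fun {Ω T nE ν f C₀ γ σ σh u lam c} hT hΩ hreg hC₀ hν hnE hsol hpost K hK q hq =>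
    ?_⟩
  have hδ := sub_mem_symPolySpace (hpost.mem_sigma K hK) (hsol.mem_sigma K hK)
  have ho : ∀ τ ∈ symPolySpace ((k : ℤ) - 2),
      intElem K (fun x => frob (evT (σh K - σ K) x) (evT τ x)) = 0 :=
    fun τ hτ => hpost.orthogonal hK hτ
  refine h (hT.triangle K hK) (hreg K hK) _ hδ ?_ _ _ (stab_nonneg hC₀ γ K) ?_
  · rwa [sub_sub, one_add_one_eq_two]
  · rw [intBdry_correction hT hΩ hν hnE hsol hpost hK hδ ho]
    congr 1
    have hq0 := ho q hq
    simp only [frob_comm (evT (σh K - σ K) _)] at hq0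
    simp only [evT_sub _ q, frob_sub_left (evT (cOpPoly _ _) _)]
    rw [intElem_sub (continuous_frob _ _) (continuous_frob _ _), hq0, sub_zero]

/-- On an element of both triangulations, the difference of the corrections is bounded by the
difference of the bending moments. -/
theorem exists_normSq_correction_sub_le (k : ℕ) (κ : ℝ) : ∃ C, 0 < C ∧
    ∀ {Ω : Set Plane} {T Ts : Finset Simp} {nE nEs : Simp → Plane} {ν f : Plane → ℝ} {C₀ γ : ℝ}
      {σ σh σs σhs : Simp → PolyTensor} {u lam us lams : Simp → Poly} {c cs : Simp → ℝ},
    IsTriangulation Ω T → IsTriangulation Ω Ts → IsOpen Ω → IsShapeRegular κ T → 0 ≤ C₀ →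
    (∀ K ∈ T, ∀ x ∈ interior (hull K), ν x = c K) →
    (∀ K ∈ Ts, ∀ x ∈ interior (hull K), ν x = cs K) →
    (∀ e ∈ meshEdges T, IsUnitNormal e (nE e)) →
    (∀ e ∈ meshEdges Ts, IsUnitNormal e (nEs e)) →
    IsSolution Ω T k nE ν f C₀ γ σ u lam → IsPostprocessed T k nE C₀ γ σ u lam σh →
    IsSolution Ω Ts k nEs ν f C₀ γ σs us lams → IsPostprocessed Ts k nEs C₀ γ σs us lams σhs →
    ∀ K ∈ T, K ∈ Ts → cs K = c K →
      normSq K ((σhs K - σs K) - (σh K - σ K)) ≤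
        C * (meshSize K * stab C₀ γ K) ^ 2 * normSq K (cOpPoly (c K) (σs K - σ K)) := by
  obtain ⟨C, hC, h⟩ := exists_stability ((k : ℤ) - 1) κ
  refine ⟨C, hC, fun {Ω T Ts nE nEs ν f C₀ γ σ σh σs σhs u lam us lams c cs} hT hTs hΩ hreg hC₀ hν
    hνs hnE hnEs hsol hpost hsols hposts K hK hKs hcs => ?_⟩
  have hKt := hT.triangle K hK
  have hδ := sub_mem_symPolySpace
    (sub_mem_symPolySpace (hposts.mem_sigma K hKs) (hsols.mem_sigma K hKs))
    (sub_mem_symPolySpace (hpost.mem_sigma K hK) (hsol.mem_sigma K hK))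
  set δ := σh K - σ K with hδ1
  set δs := σhs K - σs K with hδs1
  have ho : ∀ τ ∈ symPolySpace ((k : ℤ) - 2),
      intElem K (fun x => frob (evT (δs - δ) x) (evT τ x)) = 0 := fun τ hτ => by
    simp only [evT_sub δs, frob_sub_left]
    rw [intElem_sub (continuous_frob _ _) (continuous_frob _ _), hposts.orthogonal hKs hτ,
      hpost.orthogonal hK hτ, sub_zero]
  refine h hKt (hreg K hK) _ hδ ?_ _ _ (stab_nonneg hC₀ γ K) ?_
  · rwa [sub_sub, one_add_one_eq_two]
  · have h1 := intBdry_correction hT hΩ hν hnE hsol hpost hK hδ ho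
    have h2 := intBdry_correction hTs hΩ hνs hnEs hsols hposts hKs hδ ho
    rw [← hδ1] at h1
    rw [← hδs1, hcs] at h2
    have hc : ∀ (τ : PolyTensor) (e : Simp), Continuous fun x =>
        bil (outNormal K e) (evT τ x) (outNormal K e) *
          bil (outNormal K e) (evT (δs - δ) x) (outNormal K e) := fun τ e =>
      (continuous_bil τ _ _).fun_mul (continuous_bil _ _ _)
    have e1 : ∀ (e : Simp) (x : Plane),
        bil (outNormal K e) (evT (δs - δ) x) (outNormal K e) *
          bil (outNormal K e) (evT (δs - δ) x) (outNormal K e) =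
        bil (outNormal K e) (evT δs x) (outNormal K e) *
          bil (outNormal K e) (evT (δs - δ) x) (outNormal K e) -
        bil (outNormal K e) (evT δ x) (outNormal K e) *
          bil (outNormal K e) (evT (δs - δ) x) (outNormal K e) := fun e x => by
      rw [← sub_mul, ← bil_sub, ← evT_sub]
    simp only [e1]
    rw [intBdry_sub hKt (hc δs) (hc δ), h1, h2, ← mul_sub,
      ← intElem_sub (continuous_frob _ _) (continuous_frob _ _)]
    simp only [cOpPoly_sub, evT_sub (cOpPoly _ _), frob_sub_left]

/-- The estimator is the sum of the distances of `𝒞τ` from its projection. -/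
theorem etaSq_eq {k : ℕ} {ν : Plane → ℝ} {C₀ γ : ℝ} {τ : Simp → PolyTensor} {S : Finset Simp}
    {c : Simp → ℝ} (hν : ∀ K ∈ S, ∀ x ∈ interior (hull K), ν x = c K) :
    etaSq k ν C₀ γ τ S = ∑ K ∈ S, meshSize K * stab C₀ γ K *
      normSq K (cOpPoly (c K) (τ K) -
        l2ProjT K ((k : ℤ) - 2) (fun y => cOp (ν y) (evT (τ K) y))) := by
  refine Finset.sum_congr rfl fun K hK => ?_
  congr 1
  refine intElem_congr fun x hx => ?_
  rw [evT_sub, evT_cOpPoly, hν K hK x hx]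

end HCDG

end

open HCDG in
theorem mainTheorem8 (k : ℕ) (hk : 1 ≤ k) (κ : ℝ) :
    ∃ C : ℝ, 0 < C ∧
      ∀ (Ω : Set Plane), IsOpen Ω → IsConnected Ω → Bornology.IsBounded Ω →
      ∀ (T₀ T Ts : Finset Simp),
        IsTriangulation Ω T₀ → IsTriangulation Ω T → IsTriangulation Ω Ts →
        IsRefinement T₀ T → IsRefinement T Ts →
        IsShapeRegular κ T → IsShapeRegular κ Ts →
      ∀ (ν f : Plane → ℝ), IsPoissonRatio T₀ ν → MeasureTheory.MemLp f 2 (volume.restrict Ω) →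
      ∀ (C₀ γ : ℝ), 0 ≤ C₀ → -1 < γ →
      ∀ (nE nEs : Simp → Plane),
        (∀ e ∈ meshEdges T, IsUnitNormal e (nE e)) →
        (∀ e ∈ meshEdges Ts, IsUnitNormal e (nEs e)) →
      ∀ (σ σs : Simp → PolyTensor) (u us lam lams : Simp → Poly),
        IsSolution Ω T k nE ν f C₀ γ σ u lam →
        IsSolution Ω Ts k nEs ν f C₀ γ σs us lams →
      ∀ (σh σhs : Simp → PolyTensor),
        IsPostprocessed T k nE C₀ γ σ u lam σh →
        IsPostprocessed Ts k nEs C₀ γ σs us lams σhs →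
        normC Ω ν (fun x =>
            (tensorField Ts σhs x - tensorField Ts σs x)
              - (tensorField T σh x - tensorField T σ x)) ^ 2 ≤
          C * (stabConst C₀ γ T₀ ^ 2 *
                normC Ω ν (fun x => tensorField Ts σs x - tensorField T σ x) ^ 2
              + stabConst C₀ γ T₀ * etaSq k ν C₀ γ σ (refinedElements T Ts)) := by
  classical
  obtain ⟨C₁, hC₁, hcorr⟩ := exists_normSq_correction_le k κ
  obtain ⟨C₂, hC₂, hdiff⟩ := exists_normSq_correction_sub_le k κ
  refine ⟨64 * (C₁ + C₂), by positivity, ?_⟩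
  intro Ω hΩ _ _ T₀ T Ts hT₀ hT hTs hr₀ hr hreg hregs ν f hν _ C₀ γ hC₀ hγ nE nEs hnE hnEs
    σ σs u us lam lams hsol hsols σh σhs hpost hposts
  obtain ⟨c, hc⟩ := hν.exists_const hr₀
  -- the element of the coarse triangulation that contains an element of the fine one
  have hpar : ∀ L, ∃ K, L ∈ Ts → K ∈ T ∧ hull L ⊆ hull K := fun L => by
    by_cases hL : L ∈ Ts
    · obtain ⟨K, hK, h⟩ := hr L hL
      exact ⟨K, fun _ => ⟨hK, h⟩⟩
    · exact ⟨L, fun h => absurd h hL⟩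
  choose P hP using hpar
  have hPself : ∀ L ∈ Ts, L ∈ T → P L = L := fun L hL hLT =>
    hT.eq_of_hull_subset (hP L hL).1 hLT (hTs.nonempty_interior hL) (hP L hL).2 subset_rfl
  have hcs : ∀ L ∈ Ts, 0 < c (P L) ∧ c (P L) < 1 / 2 ∧
      ∀ x ∈ interior (hull L), ν x = c (P L) := fun L hL =>
    ⟨(hc _ (hP L hL).1).1, (hc _ (hP L hL).1).2.1, fun x hx =>
      (hc _ (hP L hL).1).2.2 x (interior_mono (hP L hL).2 hx)⟩
  set X := stabConst C₀ γ T₀ with hX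
  let a : Simp → ℝ := fun K => meshSize K * stab C₀ γ K
  have ha0 : ∀ K, 0 ≤ a K := fun K => mul_nonneg (Real.sqrt_nonneg _) (stab_nonneg hC₀ γ K)
  have haX : ∀ K ∈ T, a K ≤ X := fun K hK =>
    meshSize_mul_stab_le_stabConst hC₀ hγ hT₀ hT hr₀ hK
  have haP : ∀ L ∈ Ts, a L ≤ a (P L) := fun L hL =>
    meshSize_mul_stab_mono hC₀ hγ (hTs.triangle L hL) (hT.triangle _ (hP L hL).1) (hP L hL).2
  let q : Simp → PolyTensor := fun K =>
    l2ProjT K ((k : ℤ) - 2) (fun y => cOp (ν y) (evT (σ K) y))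
  have hq : ∀ K ∈ T, q K ∈ symPolySpace ((k : ℤ) - 2) := fun K hK =>
    l2ProjT_cOp_mem _ _ _ (hsol.mem_sigma K hK).1
  let G : Simp → PolyTensor := fun K => cOpPoly (c K) (σ K) - q K
  let δ : Simp → PolyTensor := fun K => σh K - σ K
  let δs : Simp → PolyTensor := fun K => σhs K - σs K
  let ε : Simp → PolyTensor := fun L => σs L - σ (P L)
  -- both norms as sums over the fine triangulation
  have hfield : ∀ (τ : Simp → PolyTensor), ∀ L ∈ Ts, ∀ x ∈ interior (hull L),
      tensorField T τ x = evT (τ (P L)) x := fun τ L hL x hx =>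
    hT.tensorField_eq τ (hP L hL).1 (interior_mono (hP L hL).2 hx)
  have hL := (normC_sq_bounds hTs hΩ (c := fun L => c (P L)) hcs
    (F := fun x => (tensorField Ts σhs x - tensorField Ts σs x)
              - (tensorField T σh x - tensorField T σ x))
    (g := fun L => δs L - δ (P L)) (fun L hL x hx => by
      simp only [hfield _ L hL x hx, hTs.tensorField_eq _ hL hx, evT_sub, δs, δ])).2
  have hR := (normC_sq_bounds hTs hΩ (c := fun L => c (P L)) hcs
    (F := fun x => tensorField Ts σs x - tensorField T σ x)
    (g := ε) (fun L hL x hx => by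
      simp only [hfield _ L hL x hx, hTs.tensorField_eq _ hL hx, evT_sub, ε])).1
  change _ ≤ 2 * ∑ L ∈ Ts, normSq L (δs L - δ (P L)) at hL
  change ∑ L ∈ Ts, normSq L (ε L) ≤ _ at hR
  -- the contribution of an element that is not in the coarse triangulation
  let F : Simp → Simp → ℝ := fun K L =>
    4 * C₁ * (X * a K) * normSq L (G K) + 2 * normSq L (δ K)
  have hcε : ∀ L ∈ Ts, normSq L (cOpPoly (c (P L)) (ε L)) ≤ 4 * normSq L (ε L) := fun L hL =>
    normSq_cOpPoly_le L (hcs L hL).1 (hcs L hL).2.1 _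
  have hcommon : ∀ L ∈ Ts, L ∈ T →
      normSq L (δs L - δ (P L)) ≤ 16 * (C₁ + C₂) * X ^ 2 * normSq L (ε L) := by
    intro L hL hLT
    have hPL := hPself L hL hLT
    have h1 := hdiff hT hTs hΩ hreg hC₀ (fun K hK => (hc K hK).2.2) (cs := fun L => c (P L))
      (fun K hK => (hcs K hK).2.2) hnE hnEs hsol hpost hsols hposts L hLT hL (by rw [hPL])
    have h2 := hcε L hL
    have h3 : a L ^ 2 ≤ X ^ 2 := pow_le_pow_left₀ (ha0 L) (haX L hLT) 2
    simp only [ε, hPL] at h2 ⊢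
    have hn := normSq_nonneg L (σs L - σ L)
    calc normSq L (δs L - δ L)
        ≤ C₂ * a L ^ 2 * normSq L (cOpPoly (c L) (σs L - σ L)) := h1
      _ ≤ C₂ * X ^ 2 * (4 * normSq L (σs L - σ L)) :=
          mul_le_mul (mul_le_mul_of_nonneg_left h3 hC₂.le) h2 (normSq_nonneg _ _) (by positivity)
      _ ≤ 16 * (C₁ + C₂) * X ^ 2 * normSq L (σs L - σ L) := by
          have : 0 ≤ (16 * C₁ + 12 * C₂) * (X ^ 2 * normSq L (σs L - σ L)) := by positivity
          linarith
  have hfine : ∀ L ∈ Ts, normSq L (δs L - δ (P L)) ≤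
      16 * (C₁ + C₂) * X ^ 2 * normSq L (ε L) + F (P L) L := by
    intro L hL
    have hPT := (hP L hL).1
    -- on the fine element, `𝒞σs` is compared with the projection on its coarse parent
    have h1 := hcorr hTs hΩ hregs hC₀ (c := fun L => c (P L)) (fun K hK => (hcs K hK).2.2) hnEs
      hsols hposts L hL _ (hq _ hPT)
    have h2 : cOpPoly (c (P L)) (σs L) - q (P L) = cOpPoly (c (P L)) (ε L) + G (P L) := by
      simp only [ε, G, cOpPoly_sub]; abel
    rw [h2] at h1
    have h3 := (normSq_add_le L (cOpPoly (c (P L)) (ε L)) (G (P L))).trans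
      (add_le_add_left (mul_le_mul_of_nonneg_left (hcε L hL) two_pos.le) _)
    have h4 := normSq_sub_le L (δs L) (δ (P L))
    have hnε := normSq_nonneg L (ε L)
    have hnG := normSq_nonneg L (G (P L))
    have haL : a L ≤ X := (haP L hL).trans (haX _ hPT)
    have h5 : a L ^ 2 ≤ X ^ 2 := pow_le_pow_left₀ (ha0 L) haL 2
    have h6 : a L ^ 2 ≤ X * a (P L) := by
      rw [pow_two]
      exact mul_le_mul haL (haP L hL) (ha0 L) ((ha0 L).trans haL)
    have h7 := mul_le_mul_of_nonneg_left h3 (by positivity : 0 ≤ C₁ * a L ^ 2)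
    have h8 := mul_le_mul_of_nonneg_left (mul_le_mul_of_nonneg_right h5 hnε) hC₁.le
    have h9 := mul_le_mul_of_nonneg_left (mul_le_mul_of_nonneg_right h6 hnG) hC₁.le
    have h10 : 0 ≤ C₂ * (X ^ 2 * normSq L (ε L)) := by positivity
    change normSq L (δs L) ≤ C₁ * a L ^ 2 * _ at h1
    simp only [F]
    linarith
  have hX0 : ∀ K ∈ T, 0 ≤ X := fun K hK => (ha0 K).trans (haX K hK)
  -- the elements inside one coarse element add up to at most this element
  have hfiber : ∀ K ∈ refinedElements T Ts,
      ∑ L ∈ (Ts.filter (· ∉ T)).filter (P · = K), F (P L) L ≤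
        6 * C₁ * X * (a K * normSq K (G K)) := by
    intro K hKr
    have hK : K ∈ T := (Finset.mem_sdiff.mp hKr).1
    set S := (Ts.filter (· ∉ T)).filter (P · = K) with hS
    have hSTs : S ⊆ Ts := (Finset.filter_subset _ _).trans (Finset.filter_subset _ _)
    have hPS : ∀ L ∈ S, P L = K := fun L hL => (Finset.mem_filter.mp hL).2
    have hsub : ∀ L ∈ S, hull L ⊆ hull K := fun L hL => hPS L hL ▸ (hP L (hSTs hL)).2
    have h1 : ∀ τ : PolyTensor, ∑ L ∈ S, normSq L τ ≤ normSq K τ := fun τ =>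
      hTs.sum_intElem_le hSTs hsub (continuous_frob _ _) fun x => frob_self_nonneg _
    have h2 : ∑ L ∈ S, F (P L) L =
        4 * C₁ * (X * a K) * ∑ L ∈ S, normSq L (G K) + 2 * ∑ L ∈ S, normSq L (δ K) := by
      rw [Finset.mul_sum, Finset.mul_sum, ← Finset.sum_add_distrib]
      exact Finset.sum_congr rfl fun L hL => by simp only [F, hPS L hL]
    have h3 : normSq K (δ K) ≤ C₁ * a K ^ 2 * normSq K (G K) :=
      hcorr hT hΩ hreg hC₀ (fun K hK => (hc K hK).2.2) hnE hsol hpost K hK _ (hq K hK)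
    have h4 : a K ^ 2 ≤ X * a K := by
      rw [pow_two]; exact mul_le_mul_of_nonneg_right (haX K hK) (ha0 K)
    have h5 := mul_le_mul_of_nonneg_left
      (mul_le_mul_of_nonneg_right h4 (normSq_nonneg K (G K))) hC₁.le
    have h6 := mul_le_mul_of_nonneg_left (h1 (G K))
      (mul_nonneg (by positivity : 0 ≤ 4 * C₁) (mul_nonneg (hX0 K hK) (ha0 K)))
    have h7 := h1 (δ K)
    rw [h2]
    linarith
  have hη : etaSq k ν C₀ γ σ (refinedElements T Ts) =
      ∑ K ∈ refinedElements T Ts, a K * normSq K (G K) :=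
    etaSq_eq fun K hK => (hc K (Finset.mem_sdiff.mp hK).1).2.2
  have hmaps : ∀ L ∈ Ts.filter (· ∉ T), P L ∈ refinedElements T Ts := by
    intro L hL
    obtain ⟨hLs, hLT⟩ := Finset.mem_filter.mp hL
    refine Finset.mem_sdiff.mpr ⟨(hP L hLs).1, fun hPs => hLT ?_⟩
    have := hTs.eq_of_hull_subset hPs hLs (hTs.nonempty_interior hLs) (hP L hLs).2 subset_rfl
    exact this ▸ (hP L hLs).1
  have hsumF : ∑ L ∈ Ts.filter (· ∉ T), F (P L) L ≤
      6 * C₁ * X * etaSq k ν C₀ γ σ (refinedElements T Ts) := by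
    rw [hη, Finset.mul_sum, ← Finset.sum_fiberwise_of_maps_to hmaps]
    exact Finset.sum_le_sum hfiber
  have hsum : ∑ L ∈ Ts, normSq L (δs L - δ (P L)) ≤
      16 * (C₁ + C₂) * X ^ 2 * ∑ L ∈ Ts, normSq L (ε L) +
        ∑ L ∈ Ts.filter (· ∉ T), F (P L) L := by
    rw [Finset.mul_sum, Finset.sum_filter, ← Finset.sum_add_distrib]
    refine Finset.sum_le_sum fun L hL => ?_
    by_cases hLT : L ∈ T
    · rw [if_neg (not_not.mpr hLT), add_zero]
      exact hcommon L hL hLT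
    · rw [if_pos hLT]
      exact hfine L hL
  have hXη : 0 ≤ X * etaSq k ν C₀ γ σ (refinedElements T Ts) := by
    rw [hη, Finset.mul_sum]
    exact Finset.sum_nonneg fun K hK => mul_nonneg (hX0 K (Finset.mem_sdiff.mp hK).1)
      (mul_nonneg (ha0 K) (normSq_nonneg _ _))
  have h1 := mul_le_mul_of_nonneg_left hR (by positivity : 0 ≤ 16 * (C₁ + C₂) * X ^ 2)
  have h2 := mul_nonneg hC₁.le hXη
  have h3 := mul_nonneg hC₂.le hXη
  linarith
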